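/- **Setting.** For $n\ge 0$ let $\hat L_n$ be the completed free Lie algebra over $\mathbb Q$ on generators $x_1,\dots,x_n$: the non-commutative power series in $x_1,\dots,x_n$ with rational coefficients all of whose homogeneous parts are Lie polynomials, with the topology of coefficientwise convergence ($\mathbb Q$ having its usual topology). For $p,q\in\hat L_n$ let $\mathrm{BCH}(p,q)\in\hat L_n$ be the unique Lie series with $\exp(\mathrm{BCH}(p,q))=\exp(p)\exp(q)$. An element of $\hat L_n$ is totally symmetric if it is invariant under all permutations of $x_1,\dots,x_n$. Let $\mathfrak g$ be a Lie algebra over $\mathbb Q$ (for example, a Lie algebra over a field of characteristic $0$) with a Hausdorff topology in which Lie series have values: for all $m$ and $e_1,\dots,e_m\in\mathfrak g$ there is a continuous homomorphism of Lie algebras $\hat L_m\to\mathfrak g$ with $x_i\mapsto e_i$. It is then unique, and the image of $f\in\hat L_m$ is written $f(e_1,\dots,e_m)$; in particular $\mathrm{BCH}(e,f)\in\mathfrak g$ is defined for all $e,f\in\mathfrak g$. A *$\mathfrak g$-action* on a set $X$ consists of bijections $u_e:X\to X$, $e\in\mathfrak g$, such that 1. $u_f(u_e(a))=u_{\mathrm{BCH}(e,f)}(a)$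 for all $e,f\in\mathfrak g$, $a\in X$; 2. $u_0=\mathrm{id}$; 3. if $u_e(a)=a$, then $u_{\frac12 e}(a)=a$. The action is *continuous* if $X$ is a $T_1$ topological space and $e\mapsto u_e(a)$ is continuous for every $a\in X$. **Theorem 3.2.** There are totally symmetric elements $\mu_n=\mu_n(x_1,\dots,x_n)\in\hat L_n$ with the following properties. * For every $n\ge 1$, every such $\mathfrak g$, every continuous $\mathfrak g$-action on $X$, all $x_1,\dots,x_n\in\mathfrak g$ and $a,b\in X$: if $u_{x_i}(a)=b$ for all $i=1,\dots,n$, then $u_{\mu_n(x_1,\dots,x_n)}(a)=b$. * For $n=2$ this holds for every $\mathfrak g$-action, continuous or not. * $\mu_2(x,y)=\mathrm{BCH}\bigl(x,\tfrac12\mathrm{BCH}(-x,y)\bigr)$. -/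

import Mathlib

noncomputable section

namespace GaugeAverage

/-- Formal power series with rational coefficients in `n` non-commuting indeterminates:
a coefficient for every word in the letters `0, …, n - 1`. -/
def NCSeries (n : ℕ) : Type := List (Fin n) → ℚ

namespace NCSeries

variable {n : ℕ}

instance : AddCommGroup (NCSeries n) := inferInstanceAs (AddCommGroup (List (Fin n) → ℚ))

instance : Module ℚ (NCSeries n) := inferInstanceAs (Module ℚ (List (Fin n) → ℚ))

/-- The topology of coefficientwise convergence, `ℚ` carrying its usual topology. -/
instance : TopologicalSpace (NCSeries n) := inferInstanceAs (TopologicalSpace (List (Fin n) → ℚ))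

/-- The product of series: words are multiplied by concatenation. -/
instance : Mul (NCSeries n) :=
  ⟨fun f g w => ∑ k ∈ Finset.range (w.length + 1), f (w.take k) * g (w.drop k)⟩

instance : One (NCSeries n) := ⟨fun w => if w = [] then 1 else 0⟩

theorem ext {f g : NCSeries n} (h : ∀ w, f w = g w) : f = g := funext h

theorem add_apply (f g : NCSeries n) (w : List (Fin n)) : (f + g) w = f w + g w := rfl

theorem sub_apply (f g : NCSeries n) (w : List (Fin n)) : (f - g) w = f w - g w := rfl

theorem zero_apply (w : List (Fin n)) : (0 : NCSeries n) w = 0 := rfl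

theorem smul_apply (c : ℚ) (f : NCSeries n) (w : List (Fin n)) : (c • f) w = c * f w := rfl

theorem one_apply (w : List (Fin n)) : (1 : NCSeries n) w = if w = [] then 1 else 0 := rfl

theorem mul_apply (f g : NCSeries n) (w : List (Fin n)) :
    (f * g) w = ∑ k ∈ Finset.range (w.length + 1), f (w.take k) * g (w.drop k) := rfl

theorem sum_apply {ι : Type*} (s : Finset ι) (f : ι → NCSeries n) (w : List (Fin n)) :
    (∑ i ∈ s, f i) w = ∑ i ∈ s, f i w :=
  Finset.sum_apply w s (fun i => (f i : List (Fin n) → ℚ))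

/-- The series whose coefficient at `w` is the coefficient of `f` at `c :: w`. -/
def tailAt (c : Fin n) (f : NCSeries n) : NCSeries n := fun w => f (c :: w)

theorem mul_nil (f g : NCSeries n) : (f * g) [] = f [] * g [] := by
  simp [mul_apply]

theorem mul_cons (f g : NCSeries n) (c : Fin n) (w : List (Fin n)) :
    (f * g) (c :: w) = f [] * g (c :: w) + (tailAt c f * g) w := by
  rw [mul_apply, List.length_cons, Finset.sum_range_succ', mul_apply, add_comm]
  simp [tailAt]

theorem add_mul' (f g h : NCSeries n) : (f + g) * h = f * h + g * h := by
  apply ext; intro w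
  simp only [mul_apply, add_apply, add_mul, Finset.sum_add_distrib]

theorem mul_add' (f g h : NCSeries n) : f * (g + h) = f * g + f * h := by
  apply ext; intro w
  simp only [mul_apply, add_apply, mul_add, Finset.sum_add_distrib]

theorem smul_mul' (c : ℚ) (f g : NCSeries n) : (c • f) * g = c • (f * g) := by
  apply ext; intro w
  simp only [mul_apply, smul_apply, Finset.mul_sum, mul_assoc]

theorem mul_smul' (c : ℚ) (f g : NCSeries n) : f * (c • g) = c • (f * g) := by
  apply ext; intro w
  simp only [mul_apply, smul_apply, Finset.mul_sum, mul_left_comm]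

theorem mul_assoc' (f g h : NCSeries n) : f * g * h = f * (g * h) := by
  apply ext; intro w
  induction w generalizing f with
  | nil => simp only [mul_nil, mul_assoc]
  | cons c w ih =>
    have e : tailAt c (f * g) = f [] • tailAt c g + tailAt c f * g := by
      apply ext; intro v
      exact mul_cons f g c v
    rw [mul_cons, mul_cons, mul_cons, e, add_mul', add_apply, ih, smul_mul', smul_apply,
      mul_nil]
    ring

theorem zero_mul' (f : NCSeries n) : 0 * f = 0 := by
  apply ext; intro w
  simp [mul_apply, zero_apply]

theorem mul_zero' (f : NCSeries n) : f * 0 = 0 := by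
  apply ext; intro w
  simp [mul_apply, zero_apply]

theorem one_mul' (f : NCSeries n) : 1 * f = f := by
  apply ext; intro w
  cases w with
  | nil => simp [mul_nil, one_apply]
  | cons c w =>
    have e : tailAt c (1 : NCSeries n) = 0 := by
      apply ext; intro v
      simp [tailAt, one_apply, zero_apply]
    rw [mul_cons, e, zero_mul']
    simp [one_apply, zero_apply]

theorem mul_one' (f : NCSeries n) : f * 1 = f := by
  apply ext; intro w
  induction w generalizing f with
  | nil => simp [mul_nil, one_apply]
  | cons c w ih =>
    rw [mul_cons, ih]
    simp [one_apply, tailAt]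

instance : Ring (NCSeries n) :=
  { (inferInstance : AddCommGroup (NCSeries n)), (inferInstance : Mul (NCSeries n)),
    (inferInstance : One (NCSeries n)) with
    left_distrib := mul_add'
    right_distrib := add_mul'
    zero_mul := zero_mul'
    mul_zero := mul_zero'
    mul_assoc := mul_assoc'
    one_mul := one_mul'
    mul_one := mul_one' }

instance : Algebra ℚ (NCSeries n) := Algebra.ofModule smul_mul' mul_smul'

/-- The bracket is the commutator. -/
instance : LieRing (NCSeries n) := LieRing.ofAssociativeRing

instance : LieAlgebra ℚ (NCSeries n) := LieAlgebra.ofAssociativeAlgebra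

/-- The indeterminate `x_i`. -/
def X (i : Fin n) : NCSeries n := fun w => if w = [i] then 1 else 0

/-- The homogeneous part of degree `d`. -/
def homog (d : ℕ) (f : NCSeries n) : NCSeries n := fun w => if w.length = d then f w else 0

/-- The exponential `∑ f ^ k / k!` of a series `f` without constant term. For such `f` the power
`f ^ k` has no terms of degree less than `k`, so that each coefficient is a finite sum. -/
def exp (f : NCSeries n) : NCSeries n :=
  fun w => ∑ k ∈ Finset.range (w.length + 1), (f ^ k) w / (k.factorial : ℚ)

theorem homog_add (d : ℕ) (f g : NCSeries n) : homog d (f + g) = homog d f + homog d g := by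
  apply ext; intro w
  simp only [homog, add_apply]
  split_ifs <;> simp

theorem homog_sub (d : ℕ) (f g : NCSeries n) : homog d (f - g) = homog d f - homog d g := by
  apply ext; intro w
  simp only [homog, sub_apply]
  split_ifs <;> simp

theorem homog_smul (d : ℕ) (c : ℚ) (f : NCSeries n) : homog d (c • f) = c • homog d f := by
  apply ext; intro w
  simp only [homog, smul_apply]
  split_ifs <;> simp

theorem homog_zero (d : ℕ) : homog d (0 : NCSeries n) = 0 := by
  apply ext; intro w
  simp [homog, zero_apply]

theorem homog_X (d : ℕ) (i : Fin n) : homog d (X i) = if d = 1 then X i else 0 := by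
  apply ext; intro w
  by_cases hw : w = [i]
  · subst hw
    by_cases hd : d = 1
    · simp [homog, X, hd]
    · simp [homog, hd, zero_apply, Ne.symm hd]
  · by_cases hd : d = 1 <;> simp [homog, X, hw, hd, zero_apply]

theorem homog_mul (d : ℕ) (f g : NCSeries n) :
    homog d (f * g) = ∑ p ∈ (Finset.HasAntidiagonal.antidiagonal d), homog p.1 f * homog p.2 g := by
  apply ext; intro w
  rw [sum_apply]
  simp only [mul_apply]
  rw [Finset.sum_comm]
  simp only [homog, mul_apply]
  by_cases hw : w.length = d
  · rw [if_pos hw]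
    refine Finset.sum_congr rfl fun k hk => ?_
    have hk' : k ≤ w.length := Nat.lt_succ_iff.mp (Finset.mem_range.mp hk)
    rw [Finset.sum_eq_single (k, d - k)]
    · rw [if_pos (by rw [List.length_take, min_eq_left hk']),
        if_pos (by rw [List.length_drop, hw])]
    · rintro ⟨i, j⟩ hp hne
      have hij : i + j = d := by simpa using hp
      have hki : ¬ (w.take k).length = i := by
        rw [List.length_take, min_eq_left hk']
        rintro rfl
        exact hne (by rw [← hij]; simp)
      rw [if_neg hki, zero_mul]
    · intro hn
      exact absurd (by simp only [Finset.HasAntidiagonal.mem_antidiagonal]; omega) hn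
  · rw [if_neg hw]
    symm
    refine Finset.sum_eq_zero fun k hk => Finset.sum_eq_zero ?_
    rintro ⟨i, j⟩ hp
    have hij : i + j = d := by simpa using hp
    have hk' : k ≤ w.length := Nat.lt_succ_iff.mp (Finset.mem_range.mp hk)
    simp only
    split_ifs with h1 h2
    · exfalso
      rw [List.length_take] at h1
      rw [List.length_drop] at h2
      omega
    · simp
    · simp
    · simp

theorem homog_lie (d : ℕ) (f g : NCSeries n) :
    homog d ⁅f, g⁆ = ∑ p ∈ (Finset.HasAntidiagonal.antidiagonal d), ⁅homog p.1 f, homog p.2 g⁆ := by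
  simp only [Ring.lie_def, Finset.sum_sub_distrib]
  rw [homog_sub, homog_mul, homog_mul, ← Finset.Nat.sum_antidiagonal_swap (n := d)
    (f := fun p => homog p.1 g * homog p.2 f)]
  rfl

end NCSeries

/-- The completed free Lie algebra on `n` generators over `ℚ`, realised in the usual way inside
the non-commutative power series: the series each of whose homogeneous parts is a Lie polynomial,
that is, lies in the image of the free Lie algebra. It carries the topology of coefficientwise
convergence; a sequence converges if and only if its truncations to each degree do. -/
def LieSeries (n : ℕ) : LieSubalgebra ℚ (NCSeries n) where
  carrier := {f | ∀ d, NCSeries.homog d f ∈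
    (FreeLieAlgebra.lift ℚ (NCSeries.X : Fin n → NCSeries n)).range}
  add_mem' := fun ha hb d => by
    rw [NCSeries.homog_add]
    exact add_mem (ha d) (hb d)
  zero_mem' := fun d => by
    rw [NCSeries.homog_zero]
    exact zero_mem _
  smul_mem' := fun c f hf d => by
    rw [NCSeries.homog_smul]
    exact (FreeLieAlgebra.lift ℚ (NCSeries.X : Fin n → NCSeries n)).range.smul_mem c (hf d)
  lie_mem' := fun ha hb d => by
    rw [NCSeries.homog_lie]
    exact sum_mem fun p _ => LieSubalgebra.lie_mem _ (ha p.1) (hb p.2)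

namespace LieSeries

variable {n : ℕ}

theorem X_mem (i : Fin n) : NCSeries.X i ∈ LieSeries n := by
  intro d
  rw [NCSeries.homog_X]
  split_ifs
  · exact ⟨FreeLieAlgebra.of ℚ i, FreeLieAlgebra.lift_of_apply _ i⟩
  · exact zero_mem _

/-- The generator `x_i` of the completed free Lie algebra. -/
def gen (i : Fin n) : LieSeries n := ⟨NCSeries.X i, X_mem i⟩

/-- The Baker-Campbell-Hausdorff element `BCH(p, q)` of two Lie series: the (unique) Lie series `r`
with `exp r = exp p * exp q`. It exists by the Baker-Campbell-Hausdorff theorem. -/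
def bch (p q : LieSeries n) : LieSeries n :=
  Classical.epsilon fun r : LieSeries n =>
    NCSeries.exp (r : NCSeries n) = NCSeries.exp (p : NCSeries n) * NCSeries.exp (q : NCSeries n)

/-- Invariance under all permutations `x_i ↦ x_{σ i}` of the generators. -/
def TotallySymmetric (f : LieSeries n) : Prop :=
  ∀ (σ : Equiv.Perm (Fin n)) (w : List (Fin n)), (f : NCSeries n) (w.map σ) = (f : NCSeries n) w

end LieSeries

/-- The Hausdorff topological Lie algebras `𝔤` in which Lie series (such as `BCH(e, f)`) in finitely
many elements have a value: for all `x_1, …, x_n` in `𝔤` the evaluation of Lie polynomials at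
`x_1, …, x_n` extends to a continuous Lie homomorphism on the completed free Lie algebra. By density
of the Lie polynomials this extension is unique. -/
class AdmitsLieSeries (𝔤 : Type*) [LieRing 𝔤] [LieAlgebra ℚ 𝔤] [TopologicalSpace 𝔤] : Prop
    extends T2Space 𝔤 where
  exists_eval : ∀ (n : ℕ) (x : Fin n → 𝔤), ∃ φ : LieSeries n →ₗ⁅ℚ⁆ 𝔤,
    Continuous φ ∧ ∀ i, φ (LieSeries.gen i) = x i

section Action

variable {𝔤 : Type*} [LieRing 𝔤] [LieAlgebra ℚ 𝔤] [TopologicalSpace 𝔤] [AdmitsLieSeries 𝔤]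

/-- The evaluation of Lie series in `n` indeterminates at elements `x_1, …, x_n` of `𝔤`. -/
def eval {n : ℕ} (x : Fin n → 𝔤) : LieSeries n →ₗ⁅ℚ⁆ 𝔤 :=
  (AdmitsLieSeries.exists_eval n x).choose

/-- The value `BCH(e, f)` in `𝔤` of the universal Baker-Campbell-Hausdorff series. -/
def BCH (e f : 𝔤) : 𝔤 := eval ![e, f] (LieSeries.bch (LieSeries.gen 0) (LieSeries.gen 1))

variable (𝔤) in
/-- A `𝔤`-action on a set `X`. -/
structure GAction (X : Type*) where
  /-- the bijections `u_e` -/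
  u : 𝔤 → Equiv.Perm X
  comp : ∀ (e f : 𝔤) (a : X), u f (u e a) = u (BCH e f) a
  zero : ∀ a : X, u 0 a = a
  half : ∀ (e : 𝔤) (a : X), u e a = a → u ((1 / 2 : ℚ) • e) a = a

/-- The point `u_e(a)` depends continuously on `e`, for every `a`. -/
def GAction.IsContinuous {X : Type*} [TopologicalSpace X] (A : GAction 𝔤 X) : Prop :=
  ∀ a : X, Continuous fun e : 𝔤 => A.u e a

end Action

end GaugeAverage

end

open GaugeAverage

/-!
The series `μ_n` is the barycentre of `x_1, …, x_n` for the Baker-Campbell-Hausdorff product: the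
Lie series `z` with `∑ BCH(-z, x_i) = 0`. It is obtained as the fixed point of
`F z = BCH(z, (1 / n) ∑ BCH(-z, x_i))`. To first order `F z` does not depend on `z`, and the
nonlinear part of the BCH series is contractive for the degree filtration
(`LieSeries.bch_sub_agree`), so `F` is contractive (`LieSeries.meanStep_contractive`). Hence the
fixed point exists and is unique, its coefficients are rational, and the iterates of `F` from any
starting point converge to it, each coefficient being eventually constant. Uniqueness gives total
symmetry, and for `n = 2` it identifies `μ_2` with `BCH(x, BCH(-x, y) / 2)`
(`LieSeries.mean_two`), for which the averaging property is immediate from the axioms.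

For a continuous action, the Lie series whose values fix `b` form a closed set stable under BCH and
halving. By the Lie product formula `2 ^ k • BCH(p / 2 ^ k, q / 2 ^ k) → p + q`
(`LieSeries.tendsto_bch`) and dyadic approximation, this set is closed under sums and nonnegative
rational multiples, so it contains `(1 / n) ∑ BCH(-z, x_i)` as soon as `z` and all `x_i` map `a` to
`b`. Then `F z` maps `a` to `b` too. Iterating from `x_1` and passing to the limit shows that `μ_n`
maps `a` to `b` (`GAction.u_mean`).

Two general facts about Lie series carry this. The Baker-Campbell-Hausdorff theorem
(`LieSeries.exists_exp_eq`) is proved with the Euler derivation `E`: one has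
`E (exp p) = exp p * W p`, where `W p = ∑ (-1) ^ m / (m + 1)! (ad p) ^ m (E p)` is a Lie series if
`p` is, and every Lie series is `W z` for some Lie series `z`, again by a contraction. Since the
logarithmic derivative of `exp p * exp q` is a Lie series and determines the product,
`exp p * exp q = exp z` for some `z`. Substitution of Lie series for generators
(`LieSeries.subst`), together with the density of the Lie polynomials, gives
`eval x (bch p q) = BCH (eval x p) (eval x q)`.
-/

noncomputable section

namespace GaugeAverage

namespace NCSeries

variable {n : ℕ}

/-! ### Agreement of series in low degrees -/

/-- The series `f` and `g` have the same coefficients in all degrees less than `d`. -/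
def Agree (d : ℕ) (f g : NCSeries n) : Prop := ∀ w : List (Fin n), w.length < d → f w = g w

theorem neg_apply (f : NCSeries n) (w : List (Fin n)) : (-f) w = -f w := rfl

namespace Agree

variable {d e : ℕ} {f f' g g' h : NCSeries n}

theorem refl (d : ℕ) (f : NCSeries n) : Agree d f f := fun _ _ => rfl

theorem symm (H : Agree d f g) : Agree d g f := fun w hw => (H w hw).symm

theorem trans (H : Agree d f g) (K : Agree d g h) : Agree d f h :=
  fun w hw => (H w hw).trans (K w hw)

theorem mono (hde : e ≤ d) (H : Agree d f g) : Agree e f g := fun w hw => H w (hw.trans_le hde)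

theorem add (H : Agree d f g) (K : Agree d f' g') : Agree d (f + f') (g + g') := fun w hw => by
  rw [add_apply, add_apply, H w hw, K w hw]

theorem sub (H : Agree d f g) (K : Agree d f' g') : Agree d (f - f') (g - g') := fun w hw => by
  rw [sub_apply, sub_apply, H w hw, K w hw]

theorem neg (H : Agree d f g) : Agree d (-f) (-g) := fun w hw => by
  rw [neg_apply, neg_apply, H w hw]

theorem smul (c : ℚ) (H : Agree d f g) : Agree d (c • f) (c • g) := fun w hw => by
  rw [smul_apply, smul_apply, H w hw]

theorem sum {ι : Type*} (s : Finset ι) {f g : ι → NCSeries n} (H : ∀ i ∈ s, Agree d (f i) (g i)) :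
    Agree d (∑ i ∈ s, f i) (∑ i ∈ s, g i) := fun w hw => by
  rw [sum_apply, sum_apply]
  exact Finset.sum_congr rfl fun i hi => H i hi w hw

theorem mul (H : Agree d f g) (K : Agree d f' g') : Agree d (f * f') (g * g') := fun w hw => by
  rw [mul_apply, mul_apply]
  refine Finset.sum_congr rfl fun k _ => ?_
  rw [H _ (by rw [List.length_take]; omega), K _ (by rw [List.length_drop]; omega)]

/-- Multiplication by a series without constant term on the left raises degrees. -/
theorem left_mul (hf : f [] = 0) (K : Agree d g g') : Agree (d + 1) (f * g) (f * g') :=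
  fun w hw => by
  rw [mul_apply, mul_apply]
  refine Finset.sum_congr rfl fun k hk => ?_
  rcases Nat.eq_zero_or_pos k with rfl | hk0
  · simp [hf]
  · rw [K _ (by rw [List.length_drop]; have := Finset.mem_range.mp hk; omega)]

/-- Multiplication by a series without constant term on the right raises degrees. -/
theorem right_mul (hf : f [] = 0) (K : Agree d g g') : Agree (d + 1) (g * f) (g' * f) :=
  fun w hw => by
  rw [mul_apply, mul_apply]
  refine Finset.sum_congr rfl fun k hk => ?_
  rcases Nat.lt_or_ge k w.length with hk0 | hk0
  · rw [K _ (by rw [List.length_take]; omega)]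
  · rw [List.drop_eq_nil_of_le hk0, hf, mul_zero, mul_zero]

theorem mul_succ (hf : f [] = 0) (hg' : g' [] = 0) (H : Agree d f g) (K : Agree d f' g') :
    Agree (d + 1) (f * f') (g * g') :=
  (left_mul hf K).trans (right_mul hg' H)

theorem lie_succ (hf : f [] = 0) (hf' : f' [] = 0) (hg : g [] = 0) (hg' : g' [] = 0)
    (H : Agree d f g) (K : Agree d f' g') : Agree (d + 1) ⁅f, f'⁆ ⁅g, g'⁆ := by
  rw [Ring.lie_def, Ring.lie_def]
  exact (H.mul_succ hf hg' K).sub (K.mul_succ hf' hg H)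

theorem pow (k : ℕ) (H : Agree d f g) : Agree d (f ^ k) (g ^ k) := by
  induction k with
  | zero => rw [pow_zero, pow_zero]; exact refl _ _
  | succ k ih => rw [pow_succ, pow_succ]; exact ih.mul H

end Agree

theorem eq_of_agree {f g : NCSeries n} (H : ∀ d, Agree d f g) : f = g :=
  ext fun w => H (w.length + 1) w (Nat.lt_succ_self _)

theorem agree_one_iff {f g : NCSeries n} : Agree 1 f g ↔ f [] = g [] :=
  ⟨fun H => H [] Nat.one_pos, fun H w hw => by
    rwa [List.length_eq_zero_iff.mp (Nat.lt_one_iff.mp hw)]⟩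

theorem pow_nil {f : NCSeries n} (k : ℕ) : (f ^ k) [] = f [] ^ k := by
  induction k with
  | zero => simp [one_apply]
  | succ k ih => rw [pow_succ, mul_nil, ih, pow_succ]

theorem lie_nil (f g : NCSeries n) : ⁅f, g⁆ [] = 0 := by
  rw [Ring.lie_def, sub_apply, mul_nil, mul_nil, mul_comm, sub_self]

theorem pow_agree_zero {f : NCSeries n} (hf : f [] = 0) (k : ℕ) : Agree k (f ^ k) 0 := by
  induction k with
  | zero => intro w hw; exact absurd hw (Nat.not_lt_zero _)
  | succ k ih => rw [pow_succ', ← mul_zero f]; exact Agree.left_mul hf ih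

theorem agree_pow_succ {d : ℕ} {f g : NCSeries n} (hf : f [] = 0) (hg : g [] = 0)
    (H : Agree d f g) (k : ℕ) : Agree (d + 1) (f ^ (k + 2)) (g ^ (k + 2)) := by
  rw [pow_succ f, pow_succ g]
  exact (H.pow (k + 1)).mul_succ
    ((pow_nil (k + 1)).trans (by rw [hf, zero_pow k.succ_ne_zero])) hg H

/-! ### Formal sums -/

/-- The sum of a sequence of series, of which the `k`-th is expected to vanish in degrees less than
`k`: each coefficient is then a finite sum. -/
def fsum (f : ℕ → NCSeries n) : NCSeries n := fun w => ∑ k ∈ Finset.range (w.length + 1), f k w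

/-- The `k`-th series has no terms of degree less than `k`. -/
def Graded (f : ℕ → NCSeries n) : Prop := ∀ k, Agree k (f k) 0

theorem fsum_apply_of_le {f : ℕ → NCSeries n} (hf : Graded f) (w : List (Fin n)) {N : ℕ}
    (hN : w.length + 1 ≤ N) : fsum f w = ∑ k ∈ Finset.range N, f k w := by
  refine Finset.sum_subset (Finset.range_mono hN) fun k _ hk => hf k w ?_
  rw [Finset.mem_range] at hk
  omega

theorem fsum_agree {f : ℕ → NCSeries n} (hf : Graded f) {d N : ℕ} (hN : d ≤ N) :
    Agree d (fsum f) (∑ k ∈ Finset.range N, f k) := fun w hw => by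
  rw [fsum_apply_of_le hf w (N := N) (by omega), sum_apply]

theorem Agree.fsum {d : ℕ} {f g : ℕ → NCSeries n} (H : ∀ k, Agree d (f k) (g k)) :
    Agree d (fsum f) (fsum g) := fun w hw =>
  Finset.sum_congr rfl fun k _ => H k w hw

theorem fsum_eq_add_fsum_succ {f : ℕ → NCSeries n} (hf : Graded f) :
    fsum f = f 0 + fsum fun k => f (k + 1) := by
  apply ext; intro w
  rw [fsum_apply_of_le hf w (Nat.le_succ _), Finset.sum_range_succ', add_comm]
  rfl

theorem mul_fsum (g : NCSeries n) {f : ℕ → NCSeries n} (hf : Graded f) :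
    g * fsum f = fsum fun k => g * f k := by
  apply ext; intro w
  have h := (Agree.refl (w.length + 1) g).mul (fsum_agree hf le_rfl) w (Nat.lt_succ_self _)
  rw [h, Finset.mul_sum, sum_apply]
  rfl

/-- The Cauchy product of formal sums. -/
theorem fsum_mul_fsum {f g : ℕ → NCSeries n} (hf : Graded f) (hg : Graded g) :
    fsum f * fsum g = fsum fun k => ∑ p ∈ Finset.HasAntidiagonal.antidiagonal k, f p.1 * g p.2 := by
  apply ext; intro w
  set N := w.length + 1 with hN
  have h := (fsum_agree hf le_rfl).mul (fsum_agree hg le_rfl) w (Nat.lt_succ_self _)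
  have hfg : ∀ i j, Agree (i + j) (f i * g j) 0 := fun i j v hv => by
    rw [mul_apply, zero_apply]
    refine Finset.sum_eq_zero fun k hk => ?_
    rcases Nat.lt_or_ge k i with hki | hki
    · rw [hf i _ (by rw [List.length_take]; omega), zero_apply, zero_mul]
    · rw [hg j _ (by rw [List.length_drop]; have := Finset.mem_range.mp hk; omega), zero_apply,
        mul_zero]
  rw [h, Finset.sum_mul_sum, ← Finset.sum_product', sum_apply]
  simp only [fsum, sum_apply]
  rw [Finset.sum_sigma', ← Finset.sum_filter_of_ne (p := fun p => p.1 + p.2 < N)]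
  · refine Finset.sum_bij' (fun p _ => ⟨p.1 + p.2, p⟩) (fun s _ => s.2) ?_ ?_ ?_ ?_ ?_
    · rintro ⟨i, j⟩ h
      simp only [Finset.mem_filter, Finset.mem_product, Finset.mem_range] at h
      simp [h.2, ← hN]
    · rintro ⟨k, i, j⟩ h
      simp only [Finset.mem_sigma, Finset.mem_range, Finset.HasAntidiagonal.mem_antidiagonal] at h
      simp only [Finset.mem_filter, Finset.mem_product, Finset.mem_range]
      omega
    · rintro ⟨i, j⟩ h
      rfl
    · rintro ⟨k, i, j⟩ h
      simp only [Finset.mem_sigma, Finset.mem_range, Finset.HasAntidiagonal.mem_antidiagonal] at h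
      obtain ⟨-, rfl⟩ := h
      rfl
    · rintro ⟨i, j⟩ h
      rfl
  · rintro ⟨i, j⟩ - hne
    by_contra hlt
    exact hne (hfg i j w (by simp only at hlt; omega))

/-! ### The exponential series -/

theorem graded_pow {f : NCSeries n} (hf : f [] = 0) (c : ℕ → ℚ) : Graded fun k => c k • f ^ k :=
  fun k => by simpa using (pow_agree_zero hf k).smul (c k)

theorem exp_eq_fsum (f : NCSeries n) : exp f = fsum fun k => ((k.factorial : ℚ)⁻¹) • f ^ k := by
  apply ext; intro w
  refine Finset.sum_congr rfl fun k _ => ?_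
  exact div_eq_inv_mul _ _

theorem exp_nil (f : NCSeries n) : exp f [] = 1 := by simp [exp, one_apply]

theorem exp_zero : exp (0 : NCSeries n) = 1 := by
  have h0 : Graded fun k => ((k.factorial : ℚ)⁻¹) • (0 : NCSeries n) ^ k := graded_pow rfl _
  rw [exp_eq_fsum, fsum_eq_add_fsum_succ h0]
  apply ext; intro w
  simp [add_apply, fsum, zero_apply]

theorem exp_agree {d : ℕ} {f g : NCSeries n} (H : Agree d f g) : Agree d (exp f) (exp g) := by
  rw [exp_eq_fsum, exp_eq_fsum]
  exact Agree.fsum fun k => (H.pow k).smul _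

/-- The part `exp f - 1 - f` of the exponential of order at least two is contractive: agreement of
the arguments in degrees less than `d` gives agreement in degree `d` as well. -/
theorem expRem_agree {d : ℕ} {f g : NCSeries n} (hf : f [] = 0) (hg : g [] = 0)
    (H : Agree d f g) : Agree (d + 1) (exp f - 1 - f) (exp g - 1 - g) := by
  have key : ∀ f : NCSeries n, f [] = 0 →
      exp f - 1 - f = fsum fun k => (((k + 2).factorial : ℚ)⁻¹) • f ^ (k + 2) := by
    intro f hf
    have h1 := graded_pow hf fun k => ((k.factorial : ℚ)⁻¹)
    have h2 : Graded fun k => (((k + 1).factorial : ℚ)⁻¹) • f ^ (k + 1) := fun k =>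
      (h1 (k + 1)).mono k.le_succ
    rw [exp_eq_fsum, fsum_eq_add_fsum_succ h1, fsum_eq_add_fsum_succ h2]
    simp
  rw [key f hf, key g hg]
  exact Agree.fsum fun k => (agree_pow_succ hf hg H k).smul _

theorem agree_of_exp_agree {d : ℕ} {f g : NCSeries n} (hf : f [] = 0) (hg : g [] = 0)
    (H : Agree d (exp f) (exp g)) : Agree d f g := by
  induction d with
  | zero => intro w hw; exact absurd hw (Nat.not_lt_zero _)
  | succ d ih =>
    have h := ((H.sub (.refl _ 1)).sub (expRem_agree hf hg (ih (H.mono d.le_succ))))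
    simpa using h

theorem exp_injective {f g : NCSeries n} (hf : f [] = 0) (hg : g [] = 0) (H : exp f = exp g) :
    f = g :=
  eq_of_agree fun d => agree_of_exp_agree hf hg (H ▸ .refl d _)

theorem inv_factorial_mul_choose (i j : ℕ) :
    (((i + j).factorial : ℚ)⁻¹) * ((i + j).choose i : ℚ) =
      (i.factorial : ℚ)⁻¹ * (j.factorial : ℚ)⁻¹ := by
  have h := Nat.choose_mul_factorial_mul_factorial (Nat.le_add_right i j)
  rw [Nat.add_sub_cancel_left] at h
  rw [← h]
  have : ((i + j).choose i : ℚ) ≠ 0 := by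
    exact_mod_cast (Nat.choose_pos (Nat.le_add_right i j)).ne'
  push_cast
  field_simp

theorem exp_add {f g : NCSeries n} (hf : f [] = 0) (hg : g [] = 0) (H : Commute f g) :
    exp (f + g) = exp f * exp g := by
  rw [exp_eq_fsum, exp_eq_fsum, exp_eq_fsum, fsum_mul_fsum (graded_pow hf _) (graded_pow hg _)]
  congr 1
  funext k
  rw [H.add_pow', Finset.smul_sum]
  refine Finset.sum_congr rfl ?_
  rintro ⟨i, j⟩ hij
  rw [Finset.HasAntidiagonal.mem_antidiagonal] at hij
  simp only at hij ⊢
  subst hij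
  rw [smul_mul_smul_comm, ← Nat.cast_smul_eq_nsmul ℚ, smul_smul, inv_factorial_mul_choose]

theorem exp_mul_exp_neg {f : NCSeries n} (hf : f [] = 0) : exp f * exp (-f) = 1 := by
  rw [← exp_add hf (by rw [neg_apply, hf, neg_zero]) (Commute.neg_right (Commute.refl f)),
    add_neg_cancel, exp_zero]

theorem exp_neg_mul_exp {f : NCSeries n} (hf : f [] = 0) : exp (-f) * exp f = 1 := by
  rw [← exp_add (by rw [neg_apply, hf, neg_zero]) hf (Commute.neg_left (Commute.refl f)),
    neg_add_cancel, exp_zero]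

/-! ### The logarithmic derivative of the exponential -/

/-- The Euler derivation, which multiplies the homogeneous part of degree `d` by `d`. -/
def euler : NCSeries n →ₗ[ℚ] NCSeries n where
  toFun f := fun w => (w.length : ℚ) * f w
  map_add' _ _ := ext fun _ => mul_add _ _ _
  map_smul' _ _ := ext fun _ => mul_left_comm _ _ _

theorem euler_apply (f : NCSeries n) (w : List (Fin n)) : euler f w = (w.length : ℚ) * f w := rfl

theorem euler_nil (f : NCSeries n) : euler f [] = 0 := by simp [euler_apply]

theorem euler_mul (f g : NCSeries n) : euler (f * g) = euler f * g + f * euler g := by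
  apply ext; intro w
  simp only [euler_apply, mul_apply, add_apply, Finset.mul_sum]
  rw [← Finset.sum_add_distrib]
  refine Finset.sum_congr rfl fun k hk => ?_
  have h : w.length = (w.take k).length + (w.drop k).length := by
    rw [← List.length_append, List.take_append_drop]
  conv_lhs => rw [h]
  push_cast
  ring

theorem euler_one : euler (1 : NCSeries n) = 0 := by
  apply ext; intro w
  cases w <;> simp [euler_apply, one_apply, zero_apply]

theorem Agree.euler {d : ℕ} {f g : NCSeries n} (H : Agree d f g) :
    Agree d (euler f) (euler g) := fun w hw => by rw [euler_apply, euler_apply, H w hw]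

theorem euler_fsum (f : ℕ → NCSeries n) : euler (fsum f) = fsum fun k => euler (f k) :=
  ext fun _ => Finset.mul_sum _ _ _

/-- The iterated commutator `[p, [p, …, [p, y]]]` with `k` entries `p`. -/
def adPow (p : NCSeries n) (k : ℕ) (y : NCSeries n) : NCSeries n :=
  ((LieAlgebra.ad ℚ (NCSeries n) p) ^ k) y

theorem adPow_zero (p y : NCSeries n) : adPow p 0 y = y := rfl

theorem adPow_succ (p : NCSeries n) (k : ℕ) (y : NCSeries n) :
    adPow p (k + 1) y = ⁅p, adPow p k y⁆ := by
  rw [adPow, pow_succ']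
  rfl

theorem adPow_agree_zero {p y : NCSeries n} (hp : p [] = 0) (k : ℕ) :
    Agree k (adPow p k y) 0 := by
  induction k with
  | zero => intro w hw; exact absurd hw (Nat.not_lt_zero _)
  | succ k ih =>
    rw [adPow_succ, Ring.lie_def]
    simpa using (Agree.left_mul hp ih).sub (Agree.right_mul hp ih)

theorem graded_adPow {p : NCSeries n} (hp : p [] = 0) (c : ℕ → ℚ) (y : NCSeries n) :
    Graded fun k => c k • adPow p k y := fun k => by
  simpa using (adPow_agree_zero hp k).smul (c k)

/-- Moving a factor past a power: `y p ^ k = ∑ (-1) ^ j (k choose j) p ^ (k - j) (ad p) ^ j y`. -/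
theorem mul_pow_eq_sum_adPow (p y : NCSeries n) (k : ℕ) :
    y * p ^ k = ∑ q ∈ Finset.HasAntidiagonal.antidiagonal k,
      ((k.choose q.2 : ℚ) * (-1) ^ q.2) • (p ^ q.1 * adPow p q.2 y) := by
  set L : Module.End ℚ (NCSeries n) := LinearMap.mulLeft ℚ p with hL
  set R : Module.End ℚ (NCSeries n) := LinearMap.mulRight ℚ p with hR
  have had : LieAlgebra.ad ℚ (NCSeries n) p = L - R :=
    congrFun (LieAlgebra.ad_eq_lmul_left_sub_lmul_right (R := ℚ) (NCSeries n)) p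
  have hLR : Commute L R := LinearMap.commute_mulLeft_right p p
  have hRe : R = L + (-1 : ℚ) • LieAlgebra.ad ℚ (NCSeries n) p := by
    rw [had, neg_one_smul]; abel
  have hc : Commute L ((-1 : ℚ) • LieAlgebra.ad ℚ (NCSeries n) p) := by
    rw [had]
    exact ((Commute.refl L).sub_right hLR).smul_right _
  have h1 : y * p ^ k = (R ^ k) y := by
    rw [hR, LinearMap.pow_mulRight]; rfl
  rw [h1, hRe, hc.add_pow', LinearMap.sum_apply]
  refine Finset.sum_congr rfl ?_
  rintro ⟨i, j⟩ hij
  have hij' : i + j = k := by simpa using hij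
  rw [LinearMap.smul_apply, Module.End.mul_apply, smul_pow, LinearMap.smul_apply, map_smul, hL,
    LinearMap.pow_mulLeft, LinearMap.mulLeft_apply, ← Nat.cast_smul_eq_nsmul ℚ, smul_smul]
  have hch : k.choose i = k.choose j := by
    subst hij'; exact Nat.choose_symm_add
  rw [hch]
  rfl

/-- The derivative of a power, with all factors `p` moved to the left. -/
theorem euler_pow_succ (p : NCSeries n) (k : ℕ) :
    euler (p ^ (k + 1)) = ∑ q ∈ Finset.HasAntidiagonal.antidiagonal k,
      (((k + 1).choose (q.2 + 1) : ℚ) * (-1) ^ q.2) • (p ^ q.1 * adPow p q.2 (euler p)) := by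
  induction k with
  | zero => simp [adPow_zero]
  | succ k ih =>
    have h1 : p * euler (p ^ (k + 1)) = ∑ q ∈ Finset.HasAntidiagonal.antidiagonal (k + 1),
        (((k + 1).choose (q.2 + 1) : ℚ) * (-1) ^ q.2) • (p ^ q.1 * adPow p q.2 (euler p)) := by
      rw [ih, Finset.mul_sum, Finset.Nat.sum_antidiagonal_succ]
      simp only [Nat.choose_succ_self, Nat.cast_zero, zero_mul, zero_smul, zero_add]
      refine Finset.sum_congr rfl fun q _ => ?_
      rw [mul_smul_comm, ← mul_assoc, ← pow_succ']
    rw [pow_succ' p (k + 1), euler_mul, h1, mul_pow_eq_sum_adPow, ← Finset.sum_add_distrib]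
    refine Finset.sum_congr rfl fun q _ => ?_
    rw [← add_smul, ← add_mul, Nat.choose_succ_succ (k + 1) q.2]
    push_cast
    rfl

/-- The series `∑ (-1) ^ m / m! (ad q) ^ m y`, which is the conjugate of `y` by `exp q`. -/
def conjExp (q y : NCSeries n) : NCSeries n :=
  fsum fun m => ((-1) ^ m * (m.factorial : ℚ)⁻¹) • adPow q m y

/-- The left logarithmic derivative `∑ (-1) ^ m / (m + 1)! (ad p) ^ m (E p)` of `exp p` with respect
to the Euler derivation `E`. -/
def expLogDeriv (p : NCSeries n) : NCSeries n :=
  fsum fun m => ((-1) ^ m * ((m + 1).factorial : ℚ)⁻¹) • adPow p m (euler p)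

theorem mul_exp (q y : NCSeries n) (hq : q [] = 0) : y * exp q = exp q * conjExp q y := by
  rw [exp_eq_fsum, mul_fsum _ (graded_pow hq _), conjExp,
    fsum_mul_fsum (graded_pow hq _) (graded_adPow hq _ y)]
  congr 1
  funext k
  rw [mul_smul_comm, mul_pow_eq_sum_adPow, Finset.smul_sum]
  refine Finset.sum_congr rfl ?_
  rintro ⟨i, j⟩ hij
  have hij' : i + j = k := by simpa using hij
  subst hij'
  simp only
  rw [smul_mul_smul_comm, smul_smul, ← Nat.choose_symm_add, ← mul_assoc, inv_factorial_mul_choose]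
  congr 1
  ring

theorem euler_exp (p : NCSeries n) (hp : p [] = 0) : euler (exp p) = exp p * expLogDeriv p := by
  have hE : Graded fun k => euler (((k.factorial : ℚ)⁻¹) • p ^ k) := fun k => by
    simpa using (graded_pow hp (fun k => ((k.factorial : ℚ)⁻¹)) k).euler
  rw [exp_eq_fsum, euler_fsum, fsum_eq_add_fsum_succ hE, expLogDeriv,
    fsum_mul_fsum (graded_pow hp _) (graded_adPow hp _ _), pow_zero, map_smul, euler_one,
    smul_zero, zero_add]
  congr 1
  funext k
  rw [map_smul, euler_pow_succ, Finset.smul_sum]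
  refine Finset.sum_congr rfl ?_
  rintro ⟨i, j⟩ hij
  have hij' : i + j = k := by simpa using hij
  subst hij'
  simp only
  rw [smul_mul_smul_comm, smul_smul, add_assoc, ← Nat.choose_symm_add, ← mul_assoc,
    inv_factorial_mul_choose]
  congr 1
  ring

/-- A series is determined by its logarithmic derivative and its constant term. -/
theorem eq_of_euler_eq {f g w : NCSeries n} (hw : w [] = 0) (h0 : f [] = g [])
    (hf : euler f = f * w) (hg : euler g = g * w) : f = g := by
  refine eq_of_agree fun d => ?_
  induction d with
  | zero => intro v hv; exact absurd hv (Nat.not_lt_zero _)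
  | succ d ih =>
    intro v hv
    rcases v with _ | ⟨c, v⟩
    · exact h0
    · have h := Agree.right_mul hw ih (c :: v) hv
      rw [← hf, ← hg, euler_apply, euler_apply] at h
      exact mul_left_cancel₀ (by simp only [List.length_cons]; positivity) h

theorem expLogDeriv_nil {p : NCSeries n} : expLogDeriv p [] = 0 := by
  simp [expLogDeriv, fsum, smul_apply, adPow_zero, euler_nil]

end NCSeries

/-! ### Lie series -/

namespace LieSeries

open NCSeries

variable {n : ℕ}

theorem homog_agree {d : ℕ} {f g : NCSeries n} (H : Agree (d + 1) f g) :
    homog d f = homog d g := by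
  apply NCSeries.ext; intro w
  simp only [homog]
  split_ifs with hw
  · exact H w (by omega)
  · rfl

/-- A series that agrees with Lie series up to every degree is a Lie series. -/
theorem mem_of_agree {f : NCSeries n} (H : ∀ d, ∃ g ∈ LieSeries n, Agree d f g) :
    f ∈ LieSeries n := fun d => by
  obtain ⟨g, hg, hfg⟩ := H (d + 1)
  rw [homog_agree hfg]
  exact hg d

theorem fsum_mem {f : ℕ → NCSeries n} (hf : Graded f) (H : ∀ k, f k ∈ LieSeries n) :
    fsum f ∈ LieSeries n :=
  mem_of_agree fun d => ⟨_, sum_mem fun k _ => H k, fsum_agree hf (le_refl d)⟩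

theorem adPow_mem {p y : NCSeries n} (hp : p ∈ LieSeries n) (hy : y ∈ LieSeries n) (k : ℕ) :
    adPow p k y ∈ LieSeries n := by
  induction k with
  | zero => exact hy
  | succ k ih => rw [adPow_succ]; exact (LieSeries n).lie_mem hp ih

theorem homog_euler (d : ℕ) (f : NCSeries n) : homog d (euler f) = (d : ℚ) • homog d f := by
  apply NCSeries.ext; intro w
  simp only [homog, smul_apply, euler_apply]
  split_ifs with hw
  · rw [hw]
  · simp

theorem euler_mem {p : NCSeries n} (hp : p ∈ LieSeries n) : euler p ∈ LieSeries n := fun d => by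
  rw [homog_euler]
  exact LieSubalgebra.smul_mem _ _ (hp d)

/-- A Lie subalgebra that contains the images of the generators contains the image of the free Lie
algebra. -/
theorem range_lift_le {L : Type*} [LieRing L] [LieAlgebra ℚ L] (x : Fin n → L)
    (K : LieSubalgebra ℚ L) (hx : ∀ i, x i ∈ K) : (FreeLieAlgebra.lift ℚ x).range ≤ K := by
  rintro _ ⟨a, rfl⟩
  have h : FreeLieAlgebra.lift ℚ x =
      K.incl.comp (FreeLieAlgebra.lift ℚ fun i => (⟨x i, hx i⟩ : K)) := by
    apply FreeLieAlgebra.hom_ext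
    intro i
    simp
  change FreeLieAlgebra.lift ℚ x a ∈ K
  rw [h]
  exact (FreeLieAlgebra.lift ℚ (fun i => (⟨x i, hx i⟩ : K)) a).2

theorem range_lift_nil {f : NCSeries n}
    (hf : f ∈ (FreeLieAlgebra.lift ℚ (NCSeries.X : Fin n → NCSeries n)).range) : f [] = 0 := by
  let K : LieSubalgebra ℚ (NCSeries n) :=
    { carrier := {f | f [] = 0}
      add_mem' := fun {a b} ha hb => by
        change a [] + b [] = 0
        rw [show a [] = 0 from ha, show b [] = 0 from hb, add_zero]
      zero_mem' := rfl
      smul_mem' := fun c {a} ha => by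
        change c * a [] = 0
        rw [show a [] = 0 from ha, mul_zero]
      lie_mem' := fun {a b} _ _ => lie_nil a b }
  exact range_lift_le _ K (fun i => by change NCSeries.X i [] = 0; simp [NCSeries.X]) hf

/-- A Lie series has no constant term. -/
theorem coe_nil (p : LieSeries n) : (p : NCSeries n) [] = 0 := by
  have h := range_lift_nil (p.2 0)
  simpa [homog] using h

theorem conjExp_mem {q y : NCSeries n} (hq : q ∈ LieSeries n) (hy : y ∈ LieSeries n) :
    conjExp q y ∈ LieSeries n :=
  fsum_mem (graded_adPow (coe_nil ⟨q, hq⟩) _ y) fun k =>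
    (LieSeries n).smul_mem _ (adPow_mem hq hy k)

theorem expLogDeriv_mem {p : NCSeries n} (hp : p ∈ LieSeries n) : expLogDeriv p ∈ LieSeries n :=
  fsum_mem (graded_adPow (coe_nil ⟨p, hp⟩) _ _) fun k =>
    (LieSeries n).smul_mem _ (adPow_mem hp (euler_mem hp) k)

/-! ### Contractions of the space of Lie series -/

/-- A self-map of the Lie series is contractive if agreement of two arguments in degrees less than
`d` forces agreement of their images in degree `d` as well. -/
def Contractive (F : LieSeries n → LieSeries n) : Prop :=
  ∀ (d : ℕ) (p q : LieSeries n), Agree d (p : NCSeries n) q →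
    Agree (d + 1) (F p : NCSeries n) (F q)

namespace Contractive

variable {F : LieSeries n → LieSeries n}

theorem fixed_unique (hF : Contractive F) {p q : LieSeries n} (hp : F p = p) (hq : F q = q) :
    p = q := by
  refine Subtype.ext (eq_of_agree fun d => ?_)
  induction d with
  | zero => intro w hw; exact absurd hw (Nat.not_lt_zero _)
  | succ d ih => have := hF d p q ih; rwa [hp, hq] at this

theorem iterate_agree (hF : Contractive F) (p q : LieSeries n) (d : ℕ) :
    Agree d (F^[d] p : NCSeries n) (F^[d] q) := by
  induction d with
  | zero => intro w hw; exact absurd hw (Nat.not_lt_zero _)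
  | succ d ih => rw [Function.iterate_succ_apply', Function.iterate_succ_apply']; exact hF d _ _ ih

theorem exists_fixed (hF : Contractive F) : ∃ p, F p = p := by
  have h : ∀ d k, Agree d (F^[d] 0 : NCSeries n) (F^[d + k] 0) := fun d k => by
    rw [Function.iterate_add_apply]
    exact hF.iterate_agree _ _ d
  let z : NCSeries n := fun w => (F^[w.length + 1] 0 : NCSeries n) w
  have hz : ∀ d, Agree d z (F^[d] 0 : NCSeries n) := fun d w hw => by
    obtain ⟨k, rfl⟩ := Nat.exists_eq_add_of_le (Nat.succ_le_of_lt hw)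
    exact h (w.length + 1) k w (Nat.lt_succ_self _)
  have hmem : z ∈ LieSeries n := mem_of_agree fun d => ⟨_, (F^[d] 0).2, hz d⟩
  refine ⟨⟨z, hmem⟩, Subtype.ext (eq_of_agree fun d => ?_)⟩
  have h1 := hF d ⟨z, hmem⟩ _ (hz d)
  rw [← Function.iterate_succ_apply' F d] at h1
  exact (h1.trans (hz (d + 1)).symm).mono d.le_succ

theorem tendsto_iterate (hF : Contractive F) {p : LieSeries n} (hp : F p = p) (q : LieSeries n) :
    Filter.Tendsto (fun d => F^[d] q) Filter.atTop (nhds p) := by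
  rw [tendsto_subtype_rng]
  refine tendsto_pi_nhds.mpr fun w => ?_
  refine tendsto_const_nhds.congr' ?_
  filter_upwards [Filter.eventually_gt_atTop w.length] with d hd
  have := hF.iterate_agree p q d w hd
  rwa [Function.iterate_fixed hp] at this

end Contractive

/-! ### The Baker-Campbell-Hausdorff theorem -/

theorem adPow_euler_nil (p : NCSeries n) (k : ℕ) : adPow p k (euler p) [] = 0 := by
  cases k with
  | zero => exact euler_nil p
  | succ k => rw [adPow_succ, lie_nil]

theorem adPow_euler_agree {d : ℕ} {p q : NCSeries n} (hp : p [] = 0) (hq : q [] = 0)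
    (H : Agree d p q) (k : ℕ) : Agree d (adPow p k (euler p)) (adPow q k (euler q)) := by
  induction k with
  | zero => exact H.euler
  | succ k ih =>
    rw [adPow_succ, adPow_succ]
    exact (H.lie_succ hp (adPow_euler_nil p k) hq (adPow_euler_nil q k) ih).mono d.le_succ

theorem expLogDeriv_sub_euler_agree {d : ℕ} {p q : NCSeries n} (hp : p [] = 0) (hq : q [] = 0)
    (H : Agree d p q) : Agree (d + 1) (expLogDeriv p - euler p) (expLogDeriv q - euler q) := by
  have key : ∀ p : NCSeries n, p [] = 0 → expLogDeriv p - euler p =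
      fsum fun m => ((-1) ^ (m + 1) * ((m + 2).factorial : ℚ)⁻¹) • adPow p (m + 1) (euler p) := by
    intro p hp
    rw [expLogDeriv, fsum_eq_add_fsum_succ (graded_adPow hp _ _)]
    simp [adPow_zero]
  rw [key p hp, key q hq]
  refine Agree.fsum fun k => Agree.smul _ ?_
  rw [adPow_succ, adPow_succ]
  exact H.lie_succ hp (adPow_euler_nil p k) hq (adPow_euler_nil q k) (adPow_euler_agree hp hq H k)

/-- Division of the homogeneous part of degree `d` by `d`; the constant term is discarded by the
convention `x / 0 = 0`. -/
def eulerInv (f : NCSeries n) : NCSeries n := fun w => (w.length : ℚ)⁻¹ * f w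

theorem euler_eulerInv {f : NCSeries n} (hf : f [] = 0) : euler (eulerInv f) = f := by
  apply NCSeries.ext; intro w
  rcases w with _ | ⟨c, w⟩
  · rw [euler_nil, hf]
  · exact mul_inv_cancel_left₀ (by simp only [List.length_cons]; positivity) _

theorem eulerInv_mem {p : NCSeries n} (hp : p ∈ LieSeries n) : eulerInv p ∈ LieSeries n :=
  fun d => by
  have h : homog d (eulerInv p) = (d : ℚ)⁻¹ • homog d p := by
    apply NCSeries.ext; intro w
    simp only [homog, smul_apply, eulerInv]
    split_ifs with hw
    · rw [hw]
    · simp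
  rw [h]
  exact LieSubalgebra.smul_mem _ _ (hp d)

/-- Every Lie series is the logarithmic derivative of the exponential of a Lie series. -/
theorem exists_expLogDeriv_eq (w : LieSeries n) :
    ∃ z : LieSeries n, expLogDeriv (z : NCSeries n) = w := by
  let G : LieSeries n → LieSeries n := fun z =>
    ⟨eulerInv ((w : NCSeries n) - (expLogDeriv (z : NCSeries n) - euler (z : NCSeries n))),
      eulerInv_mem (sub_mem w.2 (sub_mem (expLogDeriv_mem z.2) (euler_mem z.2)))⟩
  have hG : Contractive G := fun d p q H v hv => by
    have h := (Agree.refl (d + 1) (w : NCSeries n)).sub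
      (expLogDeriv_sub_euler_agree (coe_nil p) (coe_nil q) H) v hv
    exact congrArg ((v.length : ℚ)⁻¹ * ·) h
  obtain ⟨z, hz⟩ := hG.exists_fixed
  refine ⟨z, ?_⟩
  have h0 : ((w : NCSeries n) - (expLogDeriv (z : NCSeries n) - euler (z : NCSeries n))) [] = 0 := by
    rw [sub_apply, sub_apply, coe_nil, expLogDeriv_nil, euler_nil, sub_zero, sub_zero]
  have h1 := euler_eulerInv h0
  rw [show eulerInv _ = (z : NCSeries n) from congrArg Subtype.val hz] at h1
  have h2 : (w : NCSeries n) - expLogDeriv (z : NCSeries n) =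
      (w : NCSeries n) - (expLogDeriv (z : NCSeries n) - euler (z : NCSeries n)) -
        euler (z : NCSeries n) := by abel
  rw [← h1, sub_self] at h2
  exact (sub_eq_zero.mp h2).symm

/-- The Baker-Campbell-Hausdorff theorem: `exp p * exp q` has a Lie series for logarithmic
derivative, hence is the exponential of a Lie series. -/
theorem exists_exp_eq (p q : LieSeries n) :
    ∃ r : LieSeries n, exp (r : NCSeries n) = exp (p : NCSeries n) * exp (q : NCSeries n) := by
  obtain ⟨z, hz⟩ := exists_expLogDeriv_eq
    (⟨_, add_mem (conjExp_mem q.2 (expLogDeriv_mem p.2)) (expLogDeriv_mem q.2)⟩ : LieSeries n)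
  refine ⟨z, eq_of_euler_eq (w := expLogDeriv (z : NCSeries n)) expLogDeriv_nil ?_
    (euler_exp _ (coe_nil z)) ?_⟩
  · rw [mul_nil, exp_nil, exp_nil, exp_nil, mul_one]
  · rw [hz, euler_mul, euler_exp _ (coe_nil p), euler_exp _ (coe_nil q), mul_assoc,
      mul_exp _ _ (coe_nil q), mul_add, mul_assoc, mul_assoc]

theorem exp_bch (p q : LieSeries n) :
    exp (bch p q : NCSeries n) = exp (p : NCSeries n) * exp (q : NCSeries n) :=
  Classical.epsilon_spec (exists_exp_eq p q)

theorem exp_injective {p q : LieSeries n} (h : exp (p : NCSeries n) = exp (q : NCSeries n)) :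
    p = q :=
  Subtype.ext (NCSeries.exp_injective (coe_nil p) (coe_nil q) h)

theorem coe_neg (p : LieSeries n) : ((-p : LieSeries n) : NCSeries n) = -p := rfl

theorem coe_add (p q : LieSeries n) : ((p + q : LieSeries n) : NCSeries n) = p + q := rfl

theorem coe_smul (c : ℚ) (p : LieSeries n) : ((c • p : LieSeries n) : NCSeries n) = c • p := rfl

theorem coe_zero : ((0 : LieSeries n) : NCSeries n) = 0 := rfl

theorem coe_sum {ι : Type*} (s : Finset ι) (f : ι → LieSeries n) :
    ((∑ i ∈ s, f i : LieSeries n) : NCSeries n) = ∑ i ∈ s, (f i : NCSeries n) :=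
  map_sum (LieSeries n).incl f s

theorem bch_neg_right (p : LieSeries n) : bch p (-p) = 0 := by
  apply exp_injective
  rw [exp_bch, coe_neg, exp_mul_exp_neg (coe_nil p), coe_zero, exp_zero]

theorem bch_zero_right (p : LieSeries n) : bch p 0 = p := by
  apply exp_injective
  rw [exp_bch, coe_zero, exp_zero, mul_one]

theorem bch_self (p : LieSeries n) : bch p p = p + p := by
  apply exp_injective
  rw [exp_bch, coe_add, exp_add (coe_nil p) (coe_nil p) (Commute.refl _)]

theorem bch_agree {d : ℕ} {p p' q q' : LieSeries n} (H : Agree d (p : NCSeries n) p')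
    (K : Agree d (q : NCSeries n) q') : Agree d (bch p q : NCSeries n) (bch p' q') := by
  refine agree_of_exp_agree (coe_nil _) (coe_nil _) ?_
  rw [exp_bch, exp_bch]
  exact (exp_agree H).mul (exp_agree K)

/-- The nonlinear part of the Baker-Campbell-Hausdorff series is contractive. -/
theorem bch_sub_agree {d : ℕ} {p p' q q' : LieSeries n} (H : Agree d (p : NCSeries n) p')
    (K : Agree d (q : NCSeries n) q') :
    Agree (d + 1) ((bch p q - p - q : LieSeries n) : NCSeries n)
      ((bch p' q' - p' - q' : LieSeries n) : NCSeries n) := by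
  -- Subtract the linear terms from `exp (bch p q) = exp p * exp q`.
  have key : ∀ p q : LieSeries n, ((bch p q - p - q : LieSeries n) : NCSeries n) =
      (exp (p : NCSeries n) - 1 - p) + (exp (q : NCSeries n) - 1 - q) +
        (exp (p : NCSeries n) - 1) * (exp (q : NCSeries n) - 1) -
        (exp (bch p q : NCSeries n) - 1 - bch p q) := fun p q => by
    rw [exp_bch]
    change (bch p q : NCSeries n) - p - q = _
    noncomm_ring
  have h0 : ∀ p : NCSeries n, (exp p - 1) [] = 0 := fun p => by
    rw [sub_apply, exp_nil, one_apply, if_pos rfl, sub_self]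
  rw [key, key]
  exact (((expRem_agree (coe_nil p) (coe_nil p') H).add
    (expRem_agree (coe_nil q) (coe_nil q') K)).add
      (((exp_agree H).sub (.refl d 1)).mul_succ (h0 _) (h0 _) ((exp_agree K).sub (.refl d 1)))).sub
        (expRem_agree (coe_nil _) (coe_nil _) (bch_agree H K))

end LieSeries

namespace NCSeries

variable {m n : ℕ}

/-! ### Homomorphisms between algebras of series -/

/-- A map between algebras of series preserves agreement in low degrees. -/
def Filtered (φ : NCSeries m → NCSeries n) : Prop :=
  ∀ (d : ℕ) (f g : NCSeries m), Agree d f g → Agree d (φ f) (φ g)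

theorem map_exp (φ : NCSeries m →ₐ[ℚ] NCSeries n) (hφ : Filtered φ) {f : NCSeries m}
    (hf : f [] = 0) : φ (exp f) = exp (φ f) := by
  have hf' : (φ f) [] = 0 := by
    have h := hφ 1 f 0 (agree_one_iff.mpr hf)
    rw [map_zero] at h
    exact agree_one_iff.mp h
  refine eq_of_agree fun d => ?_
  rw [exp_eq_fsum, exp_eq_fsum]
  have h1 := hφ d _ _ (fsum_agree (graded_pow hf fun k => ((k.factorial : ℚ)⁻¹)) (le_refl d))
  have h2 := fsum_agree (graded_pow hf' fun k => ((k.factorial : ℚ)⁻¹)) (le_refl d)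
  refine h1.trans (Agree.symm ?_)
  simpa only [map_sum, map_smul, map_pow] using h2

theorem agree_sum_homog (f : NCSeries n) (d : ℕ) :
    Agree d f (∑ k ∈ Finset.range d, homog k f) := fun w hw => by
  rw [sum_apply, Finset.sum_eq_single w.length]
  · simp [homog]
  · intro k _ hk
    simp only [homog]
    rw [if_neg (Ne.symm hk)]
  · intro h
    exact absurd (Finset.mem_range.mpr hw) h

theorem map_mem_lieSeries (φ : NCSeries m →ₐ[ℚ] NCSeries n) (hφ : Filtered φ)
    (hX : ∀ i, φ (X i) ∈ LieSeries n) {f : NCSeries m} (hf : f ∈ LieSeries m) :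
    φ f ∈ LieSeries n := by
  refine LieSeries.mem_of_agree fun d => ⟨_, ?_, hφ d _ _ (agree_sum_homog f d)⟩
  rw [map_sum]
  refine sum_mem fun k _ => ?_
  exact LieSeries.range_lift_le X ((LieSeries n).comap (φ : NCSeries m →ₗ⁅ℚ⁆ NCSeries n)) hX (hf k)

/-- The homomorphism of Lie series induced by a homomorphism of algebras of series that maps
generators to Lie series. -/
def lieMap (φ : NCSeries m →ₐ[ℚ] NCSeries n) (hφ : Filtered φ)
    (hX : ∀ i, φ (X i) ∈ LieSeries n) : LieSeries m →ₗ⁅ℚ⁆ LieSeries n where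
  toFun f := ⟨φ f, map_mem_lieSeries φ hφ hX f.2⟩
  map_add' _ _ := Subtype.ext (map_add φ _ _)
  map_smul' c _ := Subtype.ext (map_smul φ c _)
  map_lie' {f g} := Subtype.ext ((φ : NCSeries m →ₗ⁅ℚ⁆ NCSeries n).map_lie f g)

theorem coe_lieMap (φ : NCSeries m →ₐ[ℚ] NCSeries n) (hφ : Filtered φ)
    (hX : ∀ i, φ (X i) ∈ LieSeries n) (f : LieSeries m) :
    (lieMap φ hφ hX f : NCSeries n) = φ f := rfl

theorem lieMap_bch (φ : NCSeries m →ₐ[ℚ] NCSeries n) (hφ : Filtered φ)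
    (hX : ∀ i, φ (X i) ∈ LieSeries n) (p q : LieSeries m) :
    lieMap φ hφ hX (LieSeries.bch p q) =
      LieSeries.bch (lieMap φ hφ hX p) (lieMap φ hφ hX q) := by
  apply LieSeries.exp_injective
  rw [LieSeries.exp_bch]
  simp only [coe_lieMap]
  rw [← map_exp φ hφ (LieSeries.coe_nil _), ← map_exp φ hφ (LieSeries.coe_nil _),
    ← map_exp φ hφ (LieSeries.coe_nil _), LieSeries.exp_bch, map_mul]

/-- Multiplication of the homogeneous part of degree `d` by `t ^ d`. -/
def scale (t : ℚ) : NCSeries n →ₐ[ℚ] NCSeries n :=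
  AlgHom.ofLinearMap
    { toFun := fun f w => t ^ w.length * f w
      map_add' := fun _ _ => ext fun _ => mul_add _ _ _
      map_smul' := fun _ _ => ext fun _ => mul_left_comm _ _ _ }
    (by
      apply ext; intro w
      change t ^ w.length * (1 : NCSeries n) w = (1 : NCSeries n) w
      cases w <;> simp [one_apply])
    (fun f g => by
      apply ext; intro w
      change t ^ w.length * (f * g) w =
        ∑ k ∈ Finset.range (w.length + 1), (t ^ (w.take k).length * f (w.take k)) *
          (t ^ (w.drop k).length * g (w.drop k))
      rw [mul_apply, Finset.mul_sum]
      refine Finset.sum_congr rfl fun k _ => ?_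
      have h : w.length = (w.take k).length + (w.drop k).length := by
        rw [← List.length_append, List.take_append_drop]
      conv_lhs => rw [h, pow_add]
      ring)

theorem scale_apply (t : ℚ) (f : NCSeries n) (w : List (Fin n)) :
    scale t f w = t ^ w.length * f w := rfl

theorem scale_filtered (t : ℚ) : Filtered (scale (n := n) t) := fun d f g H w hw => by
  rw [scale_apply, scale_apply, H w hw]

theorem scale_X (t : ℚ) (i : Fin n) : scale t (X i) = t • X i := by
  apply ext; intro w
  rw [scale_apply, smul_apply]
  by_cases hw : w = [i]
  · rw [hw, List.length_singleton, pow_one]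
  · simp [X, hw]

/-- The action of a permutation of the generators on series. -/
def permute (σ : Equiv.Perm (Fin n)) : NCSeries n →ₐ[ℚ] NCSeries n :=
  AlgHom.ofLinearMap
    { toFun := fun f w => f (w.map σ)
      map_add' := fun _ _ => rfl
      map_smul' := fun _ _ => rfl }
    (by
      apply ext; intro w
      change (1 : NCSeries n) (w.map σ) = (1 : NCSeries n) w
      cases w <;> simp [one_apply])
    (fun f g => by
      apply ext; intro w
      change (f * g) (w.map σ) =
        ∑ k ∈ Finset.range (w.length + 1), f ((w.take k).map σ) * g ((w.drop k).map σ)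
      rw [mul_apply, List.length_map]
      simp only [List.map_take, List.map_drop])

theorem permute_apply (σ : Equiv.Perm (Fin n)) (f : NCSeries n) (w : List (Fin n)) :
    permute σ f w = f (w.map σ) := rfl

theorem permute_filtered (σ : Equiv.Perm (Fin n)) : Filtered (permute σ) := fun d f g H w hw => by
  rw [permute_apply, permute_apply, H _ (by rwa [List.length_map])]

theorem permute_X (σ : Equiv.Perm (Fin n)) (i : Fin n) : permute σ (X i) = X (σ.symm i) := by
  apply ext; intro w
  rw [permute_apply]
  have h : w.map σ = [i] ↔ w = [σ.symm i] := by
    rw [List.map_eq_singleton_iff]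
    constructor
    · rintro ⟨a, rfl, rfl⟩
      simp
    · rintro rfl
      exact ⟨_, rfl, by simp⟩
  simp only [X, h]

/-! ### Substitution of series without constant term -/

/-- The approximation of the substitution of `x` for the generators that uses words of length less
than `d`, computed by splitting off first letters. -/
def substAux (x : Fin m → NCSeries n) : ℕ → NCSeries m → NCSeries n
  | 0, _ => 0
  | d + 1, f => f [] • (1 : NCSeries n) + ∑ c, x c * substAux x d (tailAt c f)

section substAux

variable {x : Fin m → NCSeries n}

theorem substAux_agree_succ (hx : ∀ i, x i [] = 0) (d : ℕ) (f : NCSeries m) :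
    Agree d (substAux x d f) (substAux x (d + 1) f) := by
  induction d generalizing f with
  | zero => intro w hw; exact absurd hw (Nat.not_lt_zero _)
  | succ d ih =>
    exact (Agree.refl _ _).add (Agree.sum _ fun c _ => Agree.left_mul (hx c) (ih _))

theorem substAux_agree_of_le (hx : ∀ i, x i [] = 0) {d e : ℕ} (hde : d ≤ e) (f : NCSeries m) :
    Agree d (substAux x d f) (substAux x e f) := by
  induction e, hde using Nat.le_induction with
  | base => exact .refl _ _
  | succ e he ih => exact ih.trans ((substAux_agree_succ hx e f).mono he)

theorem substAux_add (d : ℕ) (f g : NCSeries m) :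
    substAux x d (f + g) = substAux x d f + substAux x d g := by
  induction d generalizing f g with
  | zero => simp [substAux]
  | succ d ih =>
    have h : ∀ c, tailAt c (f + g) = tailAt c f + tailAt c g := fun c => rfl
    simp only [substAux, h, ih, mul_add, Finset.sum_add_distrib, add_apply, add_smul]
    abel

theorem substAux_smul (d : ℕ) (a : ℚ) (f : NCSeries m) :
    substAux x d (a • f) = a • substAux x d f := by
  induction d generalizing f with
  | zero => simp [substAux]
  | succ d ih =>
    have h : ∀ c, tailAt c (a • f) = a • tailAt c f := fun c => rfl
    simp only [substAux, h, ih, mul_smul_comm, Finset.smul_sum, smul_apply, smul_add, smul_smul]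

theorem Agree.substAux (hx : ∀ i, x i [] = 0) {d : ℕ} {f g : NCSeries m} (H : Agree d f g) :
    Agree d (substAux x d f) (substAux x d g) := by
  induction d generalizing f g with
  | zero => intro w hw; exact absurd hw (Nat.not_lt_zero _)
  | succ d ih =>
    refine Agree.add ?_ (Agree.sum _ fun c _ => Agree.left_mul (hx c) (ih fun w hw => ?_))
    · rw [H [] d.succ_pos]; exact .refl _ _
    · exact H (c :: w) (Nat.succ_lt_succ hw)

theorem continuous_substAux_apply (d : ℕ) (w : List (Fin n)) :
    Continuous fun f : NCSeries m => substAux x d f w := by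
  induction d generalizing w with
  | zero => exact continuous_const
  | succ d ih =>
    have h : ∀ f : NCSeries m, substAux x (d + 1) f w = f [] * (1 : NCSeries n) w +
        ∑ c, ∑ k ∈ Finset.range (w.length + 1),
          x c (w.take k) * substAux x d (tailAt c f) (w.drop k) := fun f => by
      rw [substAux, add_apply, smul_apply, sum_apply]
      rfl
    simp only [h]
    have ht : ∀ c : Fin m, Continuous (tailAt c : NCSeries m → NCSeries m) := fun c =>
      continuous_pi fun v => continuous_apply (c :: v)
    refine ((continuous_apply ([] : List (Fin m))).mul continuous_const).add ?_
    exact continuous_finsetSum _ fun c _ => continuous_finsetSum _ fun k _ =>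
      continuous_const.mul ((ih _).comp (ht c))

end substAux

/-- The function underlying the substitution of `x` for the generators. -/
def substFun (x : Fin m → NCSeries n) (f : NCSeries m) : NCSeries n :=
  fun w => substAux x (w.length + 1) f w

section substFun

variable {x : Fin m → NCSeries n}

theorem substFun_agree (hx : ∀ i, x i [] = 0) (d : ℕ) (f : NCSeries m) :
    Agree d (substFun x f) (substAux x d f) := fun w hw =>
  substAux_agree_of_le hx (Nat.succ_le_of_lt hw) f w (Nat.lt_succ_self _)

theorem substFun_eq (hx : ∀ i, x i [] = 0) (f : NCSeries m) :
    substFun x f = f [] • (1 : NCSeries n) + ∑ c, x c * substFun x (tailAt c f) := by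
  refine eq_of_agree fun d => ((substFun_agree hx (d + 1) f).trans ?_).mono d.le_succ
  exact (Agree.refl _ _).add
    (Agree.sum _ fun c _ => Agree.left_mul (hx c) (substFun_agree hx d _).symm)

theorem substFun_add (f g : NCSeries m) : substFun x (f + g) = substFun x f + substFun x g :=
  ext fun w => congrFun (substAux_add (w.length + 1) f g) w

theorem substFun_smul (a : ℚ) (f : NCSeries m) : substFun x (a • f) = a • substFun x f :=
  ext fun w => congrFun (substAux_smul (w.length + 1) a f) w

theorem substFun_zero : substFun x (0 : NCSeries m) = 0 := by
  simpa using substFun_smul (x := x) 0 (0 : NCSeries m)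

theorem tailAt_one (c : Fin m) : tailAt c (1 : NCSeries m) = 0 := by
  apply ext; intro v
  simp [tailAt, one_apply, zero_apply]

theorem substFun_one (hx : ∀ i, x i [] = 0) : substFun x (1 : NCSeries m) = 1 := by
  rw [substFun_eq hx]
  simp [tailAt_one, substFun_zero, one_apply]

theorem substFun_mul (hx : ∀ i, x i [] = 0) (f g : NCSeries m) :
    substFun x (f * g) = substFun x f * substFun x g := by
  refine eq_of_agree fun d => ?_
  induction d generalizing f with
  | zero => intro w hw; exact absurd hw (Nat.not_lt_zero _)
  | succ d ih =>
    have ht : ∀ c, tailAt c (f * g) = f [] • tailAt c g + tailAt c f * g := fun c =>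
      ext fun v => mul_cons f g c v
    have h1 : substFun x (f * g) = f [] • substFun x g +
        ∑ c, x c * substFun x (tailAt c f * g) := by
      rw [substFun_eq hx (f * g), substFun_eq hx g]
      simp only [ht, substFun_add, substFun_smul, mul_add, Finset.sum_add_distrib, mul_nil,
        mul_smul_comm, Finset.smul_sum, smul_add, smul_smul, add_assoc]
    have h2 : substFun x f * substFun x g = f [] • substFun x g +
        ∑ c, x c * (substFun x (tailAt c f) * substFun x g) := by
      rw [substFun_eq hx f, add_mul, smul_mul_assoc, one_mul, Finset.sum_mul]
      simp only [mul_assoc]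
    rw [h1, h2]
    exact (Agree.refl _ _).add (Agree.sum _ fun c _ => Agree.left_mul (hx c) (ih _))

theorem substFun_X (hx : ∀ i, x i [] = 0) (i : Fin m) : substFun x (X i) = x i := by
  have ht : ∀ c, tailAt c (X i : NCSeries m) = if c = i then 1 else 0 := fun c => by
    apply ext; intro v
    by_cases hc : c = i <;> simp [tailAt, X, hc, one_apply, zero_apply]
  rw [substFun_eq hx, Finset.sum_eq_single i]
  · rw [ht, if_pos rfl, substFun_one hx, mul_one]
    simp [X]
  · intro c _ hc
    rw [ht, if_neg hc, substFun_zero, mul_zero]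
  · simp

theorem substFun_filtered (hx : ∀ i, x i [] = 0) : Filtered (substFun x) := fun d f g H =>
  (substFun_agree hx d f).trans ((H.substAux hx).trans (substFun_agree hx d g).symm)

theorem continuous_substFun : Continuous (substFun x) :=
  continuous_pi fun _ => continuous_substAux_apply _ _

end substFun

/-- Substitution of the series `x i`, without constant term, for the generators. -/
def subst (x : Fin m → NCSeries n) (hx : ∀ i, x i [] = 0) : NCSeries m →ₐ[ℚ] NCSeries n :=
  AlgHom.ofLinearMap
    { toFun := substFun x
      map_add' := substFun_add
      map_smul' := substFun_smul }
    (substFun_one hx) (substFun_mul hx)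

end NCSeries

namespace LieSeries

open NCSeries

variable {m n : ℕ}

/-- Substitution of Lie series for the generators. -/
def subst (x : Fin m → LieSeries n) : LieSeries m →ₗ⁅ℚ⁆ LieSeries n :=
  lieMap (NCSeries.subst (fun i => (x i : NCSeries n)) fun i => coe_nil (x i))
    (substFun_filtered fun i => coe_nil (x i)) fun i => by
      rw [show NCSeries.subst _ _ (X i) = (x i : NCSeries n) from
        substFun_X (fun i => coe_nil (x i)) i]
      exact (x i).2

theorem subst_gen (x : Fin m → LieSeries n) (i : Fin m) : subst x (gen i) = x i :=
  Subtype.ext (substFun_X (fun i => coe_nil (x i)) i)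

theorem subst_bch (x : Fin m → LieSeries n) (p q : LieSeries m) :
    subst x (bch p q) = bch (subst x p) (subst x q) :=
  lieMap_bch _ _ _ p q

theorem continuous_subst (x : Fin m → LieSeries n) : Continuous (subst x) :=
  (continuous_substFun.comp continuous_subtype_val).subtype_mk _

/-- A continuous homomorphism on the Lie series is determined by its values on the generators,
because the Lie polynomials are dense. -/
theorem hom_ext {𝔤 : Type*} [LieRing 𝔤] [LieAlgebra ℚ 𝔤] [TopologicalSpace 𝔤] [T2Space 𝔤]
    {φ ψ : LieSeries n →ₗ⁅ℚ⁆ 𝔤} (hφ : Continuous φ) (hψ : Continuous ψ)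
    (h : ∀ i, φ (gen i) = ψ (gen i)) : φ = ψ := by
  have hpoly : φ.comp (FreeLieAlgebra.lift ℚ gen) = ψ.comp (FreeLieAlgebra.lift ℚ gen) := by
    apply FreeLieAlgebra.hom_ext
    intro i
    simpa using h i
  have hX : (LieSeries n).incl.comp (FreeLieAlgebra.lift ℚ gen) =
      FreeLieAlgebra.lift ℚ (X : Fin n → NCSeries n) := by
    apply FreeLieAlgebra.hom_ext
    intro i
    simp [gen]
  ext p
  have hp : ∀ k, ∃ a, (FreeLieAlgebra.lift ℚ gen a : LieSeries n) = homog k (p : NCSeries n) :=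
    fun k => by
    obtain ⟨a, ha⟩ := p.2 k
    exact ⟨a, (congrArg (fun f => f a) hX).trans ha⟩
  choose a ha using hp
  have hlim : Filter.Tendsto (fun d => FreeLieAlgebra.lift ℚ gen (∑ k ∈ Finset.range d, a k))
      Filter.atTop (nhds p) := by
    rw [tendsto_subtype_rng]
    refine tendsto_pi_nhds.mpr fun w => ?_
    refine tendsto_const_nhds.congr' ?_
    filter_upwards [Filter.eventually_gt_atTop w.length] with d hd
    rw [map_sum, coe_sum]
    simp only [ha]
    exact agree_sum_homog _ d w hd
  refine tendsto_nhds_unique ((hφ.tendsto p).comp hlim) ?_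
  refine ((hψ.tendsto p).comp hlim).congr fun d => ?_
  exact (congrArg (fun f => f (∑ k ∈ Finset.range d, a k)) hpoly).symm

end LieSeries

namespace LieSeries

open NCSeries Filter Topology

variable {m n : ℕ}

/-! ### Sums as limits of products -/

theorem tendsto_bch_gen :
    Tendsto (fun k : ℕ => (2 ^ k : ℚ) • bch (((2 ^ k : ℚ)⁻¹) • gen (0 : Fin 2))
      (((2 ^ k : ℚ)⁻¹) • gen 1)) atTop (𝓝 (gen 0 + gen 1)) := by
  set B : LieSeries 2 := bch (gen 0) (gen 1) with hB
  have hX : ∀ (t : ℚ) (i : Fin 2), scale t (X i) ∈ LieSeries 2 := fun t i => by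
    rw [scale_X]
    exact (LieSeries 2).smul_mem t (X_mem i)
  have hs : ∀ (t : ℚ) (w : List (Fin 2)),
      (bch (t • gen (0 : Fin 2)) (t • gen 1) : NCSeries 2) w =
        t ^ w.length * (B : NCSeries 2) w := fun t w => by
    have h0 : ∀ i : Fin 2, lieMap (scale t) (scale_filtered t) (hX t) (gen i) = t • gen i :=
      fun i => Subtype.ext (scale_X t i)
    rw [← h0, ← h0, ← lieMap_bch]
    rfl
  -- In degrees zero and one the series `B` is the sum of the generators.
  have hlin : Agree 2 (B : NCSeries 2) ((gen 0 + gen 1 : LieSeries 2) : NCSeries 2) := by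
    have h := bch_sub_agree (d := 1) (p := gen (0 : Fin 2)) (q := gen (1 : Fin 2))
      (p' := 0) (q' := 0) (agree_one_iff.mpr (by rw [coe_nil, coe_nil]))
      (agree_one_iff.mpr (by rw [coe_nil, coe_nil]))
    rw [bch_zero_right, sub_zero, sub_zero, sub_sub] at h
    have h2 := h.add (Agree.refl 2 ((gen 0 + gen 1 : LieSeries 2) : NCSeries 2))
    rwa [← coe_add, ← coe_add, sub_add_cancel, zero_add] at h2
  rw [tendsto_subtype_rng]
  refine tendsto_pi_nhds.mpr fun w => ?_
  have hval : ∀ k : ℕ, (((2 ^ k : ℚ) • bch (((2 ^ k : ℚ)⁻¹) • gen (0 : Fin 2))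
      (((2 ^ k : ℚ)⁻¹) • gen 1) : LieSeries 2) : NCSeries 2) w =
        2 ^ k * (((2 ^ k : ℚ)⁻¹) ^ w.length * (B : NCSeries 2) w) := fun k => by
    rw [coe_smul, smul_apply, hs]
  simp only [hval]
  rcases Nat.lt_or_ge w.length 2 with hw | hw
  · rw [← hlin w hw]
    refine tendsto_const_nhds.congr fun k => ?_
    rcases Nat.lt_or_ge w.length 1 with hw0 | hw1
    · have : w = [] := List.length_eq_zero_iff.mp (Nat.lt_one_iff.mp hw0)
      rw [this, coe_nil, mul_zero, mul_zero]
    · have : w.length = 1 := by omega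
      rw [this, pow_one, mul_inv_cancel_left₀ (by positivity)]
  · obtain ⟨l, hl⟩ := Nat.exists_eq_add_of_le hw
    have hz : ((gen 0 + gen 1 : LieSeries 2) : NCSeries 2) w = 0 := by
      have hne : ∀ i, w ≠ [i] := fun i h => by simp [h] at hw
      change X 0 w + X 1 w = 0
      simp [X, hne]
    rw [hz]
    have hlim : Tendsto (fun k : ℕ => ((1 / 2 : ℚ) ^ (l + 1)) ^ k * (B : NCSeries 2) w) atTop
        (𝓝 (0 * (B : NCSeries 2) w)) :=
      (tendsto_pow_atTop_nhds_zero_of_lt_one (by positivity)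
        (pow_lt_one₀ (by norm_num) (by norm_num) l.succ_ne_zero)).mul_const _
    rw [zero_mul] at hlim
    refine hlim.congr fun k => ?_
    have h2 : (2 ^ k : ℚ) ≠ 0 := by positivity
    have hpow : ((1 / 2 : ℚ) ^ (l + 1)) ^ k = 2 ^ k * ((2 ^ k : ℚ)⁻¹) ^ (l + 1 + 1) := by
      rw [pow_succ' _ (l + 1), mul_inv_cancel_left₀ h2, ← pow_mul, mul_comm (l + 1) k, pow_mul,
        one_div, inv_pow]
    rw [hpow, hl, show 2 + l = l + 1 + 1 by ring, mul_assoc]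

/-- The Lie product formula: `2 ^ k • BCH(p / 2 ^ k, q / 2 ^ k)` tends to `p + q`. -/
theorem tendsto_bch (p q : LieSeries n) :
    Tendsto (fun k : ℕ => (2 ^ k : ℚ) • bch (((2 ^ k : ℚ)⁻¹) • p) (((2 ^ k : ℚ)⁻¹) • q)) atTop
      (𝓝 (p + q)) := by
  have h := ((continuous_subst ![p, q]).tendsto _).comp tendsto_bch_gen
  have h0 : subst ![p, q] (gen 0) = p := subst_gen _ 0
  have h1 : subst ![p, q] (gen 1) = q := subst_gen _ 1
  rw [map_add, h0, h1] at h
  refine h.congr fun k => ?_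
  rw [Function.comp_apply, map_smul, subst_bch, map_smul, map_smul, h0, h1]

/-- A closed set of Lie series that is stable under the Baker-Campbell-Hausdorff product and under
halving, such as the stabilizer of a point. -/
structure IsStabilizer (S : Set (LieSeries n)) : Prop where
  isClosed : IsClosed S
  zero_mem : (0 : LieSeries n) ∈ S
  bch_mem : ∀ p ∈ S, ∀ q ∈ S, bch p q ∈ S
  half_mem : ∀ p ∈ S, (1 / 2 : ℚ) • p ∈ S

namespace IsStabilizer

variable {S : Set (LieSeries n)}

theorem inv_two_pow_smul_mem (hS : IsStabilizer S) (k : ℕ) {p : LieSeries n} (hp : p ∈ S) :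
    ((2 ^ k : ℚ)⁻¹) • p ∈ S := by
  induction k with
  | zero => simpa using hp
  | succ k ih =>
    have h := hS.half_mem _ ih
    rwa [smul_smul, one_div, ← mul_inv, ← pow_succ'] at h

theorem two_pow_smul_mem (hS : IsStabilizer S) (k : ℕ) {p : LieSeries n} (hp : p ∈ S) :
    (2 ^ k : ℚ) • p ∈ S := by
  induction k with
  | zero => simpa using hp
  | succ k ih =>
    have h := hS.bch_mem _ ih _ ih
    rwa [bch_self, ← two_smul ℚ, smul_smul, ← pow_succ'] at h

theorem add_mem (hS : IsStabilizer S) {p q : LieSeries n} (hp : p ∈ S) (hq : q ∈ S) :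
    p + q ∈ S :=
  hS.isClosed.mem_of_tendsto (tendsto_bch p q) <| Eventually.of_forall fun k =>
    hS.two_pow_smul_mem k (hS.bch_mem _ (hS.inv_two_pow_smul_mem k hp) _
      (hS.inv_two_pow_smul_mem k hq))

theorem sum_mem (hS : IsStabilizer S) {ι : Type*} (s : Finset ι) {f : ι → LieSeries n}
    (hf : ∀ i ∈ s, f i ∈ S) : ∑ i ∈ s, f i ∈ S :=
  Finset.sum_induction f (· ∈ S) (fun _ _ => hS.add_mem) hS.zero_mem hf

theorem natCast_smul_mem (hS : IsStabilizer S) (k : ℕ) {p : LieSeries n} (hp : p ∈ S) :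
    (k : ℚ) • p ∈ S := by
  rw [Nat.cast_smul_eq_nsmul]
  induction k with
  | zero => rw [zero_smul]; exact hS.zero_mem
  | succ k ih => rw [succ_nsmul]; exact hS.add_mem ih hp

/-- Nonnegative rational multiples are limits of dyadic multiples. -/
theorem smul_mem (hS : IsStabilizer S) {c : ℚ} (hc : 0 ≤ c) {p : LieSeries n} (hp : p ∈ S) :
    c • p ∈ S := by
  have h2 : Tendsto (fun k : ℕ => (2 ^ k : ℚ)) atTop atTop :=
    tendsto_pow_atTop_atTop_of_one_lt (by norm_num)
  have hq := (tendsto_nat_floor_mul_div_atTop hc).comp h2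
  have hcont : Continuous fun t : ℚ => t • p :=
    Continuous.subtype_mk (continuous_pi fun w => continuous_id.mul continuous_const) _
  refine hS.isClosed.mem_of_tendsto ((hcont.tendsto c).comp hq) <| Eventually.of_forall fun k => ?_
  have h := hS.natCast_smul_mem ⌊c * 2 ^ k⌋₊ (hS.inv_two_pow_smul_mem k hp)
  rwa [smul_smul, ← div_eq_mul_inv] at h

end IsStabilizer

/-! ### The mean of the generators -/

/-- One step of the iteration for the barycentre of `x_1, …, x_m`: `z` is moved by the average of
the `BCH(-z, x_i)`. -/
def meanStep (x : Fin m → LieSeries n) (z : LieSeries n) : LieSeries n :=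
  bch z ((1 / m : ℚ) • ∑ i, bch (-z) (x i))

theorem meanStep_contractive (hm : m ≠ 0) (x : Fin m → LieSeries n) :
    Contractive (meanStep x) := by
  intro d p q H
  set r : LieSeries n → LieSeries n := fun z => (1 / m : ℚ) • ∑ i, bch (-z) (x i) with hr
  have hneg : Agree d ((-p : LieSeries n) : NCSeries n) ((-q : LieSeries n) : NCSeries n) := H.neg
  have hrpq : Agree d (r p : NCSeries n) (r q) := by
    simp only [hr, coe_smul, coe_sum]
    exact (Agree.sum _ fun i _ => bch_agree hneg (.refl _ _)).smul _
  have hm' : (m : ℚ) ≠ 0 := Nat.cast_ne_zero.mpr hm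
  -- The terms `z` and `-z` cancel to first order, because the weights `1 / m` add up to one.
  have key : ∀ z, meanStep x z = (bch z (r z) - z - r z) +
      (1 / m : ℚ) • ∑ i, ((bch (-z) (x i) - -z - x i) + x i) := fun z => by
    have h1 : ∑ i, ((bch (-z) (x i) - -z - x i) + x i) = ∑ i, bch (-z) (x i) + (m : ℚ) • z := by
      simp only [sub_add_cancel, sub_neg_eq_add, Finset.sum_add_distrib, Finset.sum_const,
        Finset.card_univ, Fintype.card_fin, Nat.cast_smul_eq_nsmul]
    rw [h1, smul_add, smul_smul, one_div_mul_cancel hm', one_smul, meanStep]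
    simp only [hr]
    abel
  rw [key, key, coe_add, coe_add, coe_smul, coe_smul, coe_sum, coe_sum]
  exact (bch_sub_agree H hrpq).add
    ((Agree.sum _ fun i _ => (bch_sub_agree hneg (.refl _ _)).add (.refl _ _)).smul _)

theorem exists_mean (n : ℕ) :
    ∃ z : LieSeries n, (n = 0 → z = 0) ∧ meanStep (gen : Fin n → LieSeries n) z = z := by
  rcases eq_or_ne n 0 with rfl | hn
  · exact ⟨0, fun _ => rfl, by simp [meanStep, bch_zero_right]⟩
  · obtain ⟨z, hz⟩ := (meanStep_contractive hn gen).exists_fixed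
    exact ⟨z, fun h => absurd h hn, hz⟩

/-- The barycentre of the generators: the Lie series `z` with `∑ BCH(-z, x_i) = 0`, encoded as a
fixed point of `meanStep`. For `n = 0`, where every Lie series is one, it is `0`. -/
def mean (n : ℕ) : LieSeries n := (exists_mean n).choose

theorem meanStep_mean (n : ℕ) : meanStep gen (mean n) = mean n := (exists_mean n).choose_spec.2

theorem mean_totallySymmetric (n : ℕ) : TotallySymmetric (mean n) := by
  intro σ w
  have hX : ∀ i, permute σ (X i) ∈ LieSeries n := fun i => by rw [permute_X]; exact X_mem _
  set P := lieMap (permute σ) (permute_filtered σ) hX with hP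
  have hPg : ∀ i, P (gen i) = gen (σ.symm i) := fun i => Subtype.ext (permute_X σ i)
  have hfix : P (mean n) = mean n := by
    rcases eq_or_ne n 0 with rfl | hn
    · rw [show mean 0 = 0 from (exists_mean 0).choose_spec.1 rfl, map_zero]
    · refine (meanStep_contractive hn gen).fixed_unique ?_ (meanStep_mean n)
      conv_rhs => rw [← meanStep_mean n]
      simp only [meanStep]
      rw [hP, lieMap_bch, ← hP, map_smul, map_sum]
      congr 2
      refine (Equiv.sum_comp σ.symm (fun i => bch (-P (mean n)) (gen i))).symm.trans ?_
      refine Finset.sum_congr rfl fun i _ => ?_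
      rw [hP, lieMap_bch, ← hP, map_neg, hPg]
  exact congrArg (fun p : LieSeries n => (p : NCSeries n) w) hfix

/-- In group-like terms, the mean of `x` and `y` is `x (x⁻¹ y) ^ (1 / 2)`. -/
theorem mean_two :
    mean 2 = bch (gen 0) ((1 / 2 : ℚ) • bch (-gen 0) (gen 1)) := by
  set h : LieSeries 2 := (1 / 2 : ℚ) • bch (-gen 0) (gen 1) with hh
  set z := bch (gen 0) h with hz
  refine (meanStep_contractive two_ne_zero gen).fixed_unique (meanStep_mean 2) ?_
  have hsq : exp (h : NCSeries 2) * exp (h : NCSeries 2) =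
      exp ((-gen 0 : LieSeries 2) : NCSeries 2) * exp ((gen 1 : LieSeries 2) : NCSeries 2) := by
    rw [← exp_bch, ← exp_bch, bch_self, ← two_smul ℚ, hh, smul_smul, mul_one_div_cancel two_ne_zero,
      one_smul]
  have hnz : exp ((-z : LieSeries 2) : NCSeries 2) =
      exp ((-h : LieSeries 2) : NCSeries 2) * exp ((-gen 0 : LieSeries 2) : NCSeries 2) := by
    have h1 : exp (z : NCSeries 2) * (exp ((-h : LieSeries 2) : NCSeries 2) *
        exp ((-gen 0 : LieSeries 2) : NCSeries 2)) = 1 := by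
      rw [hz, exp_bch, mul_assoc, ← mul_assoc (exp (h : NCSeries 2)), coe_neg, coe_neg,
        exp_mul_exp_neg (coe_nil h), one_mul, exp_mul_exp_neg (coe_nil _)]
    calc exp ((-z : LieSeries 2) : NCSeries 2)
        = exp ((-z : LieSeries 2) : NCSeries 2) * (exp (z : NCSeries 2) *
          (exp ((-h : LieSeries 2) : NCSeries 2) *
            exp ((-gen 0 : LieSeries 2) : NCSeries 2))) := by rw [h1, mul_one]
      _ = _ := by rw [← mul_assoc, coe_neg z, exp_neg_mul_exp (coe_nil z), one_mul]
  have hx : bch (-z) (gen 0) = -h := by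
    apply exp_injective
    rw [exp_bch, hnz, mul_assoc, coe_neg (gen 0), exp_neg_mul_exp (coe_nil _), mul_one]
  have hy : bch (-z) (gen 1) = h := by
    apply exp_injective
    rw [exp_bch, hnz, mul_assoc, ← hsq, ← mul_assoc, coe_neg, exp_neg_mul_exp (coe_nil _), one_mul]
  rw [meanStep, Fin.sum_univ_two, hx, hy, neg_add_cancel, smul_zero, bch_zero_right]

end LieSeries

/-! ### Actions -/

section Action

open LieSeries

variable {𝔤 : Type*} [LieRing 𝔤] [LieAlgebra ℚ 𝔤] [TopologicalSpace 𝔤] [AdmitsLieSeries 𝔤]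

theorem continuous_eval {n : ℕ} (x : Fin n → 𝔤) : Continuous (eval x) :=
  (AdmitsLieSeries.exists_eval n x).choose_spec.1

theorem eval_gen {n : ℕ} (x : Fin n → 𝔤) (i : Fin n) : eval x (gen i) = x i :=
  (AdmitsLieSeries.exists_eval n x).choose_spec.2 i

theorem eval_bch {n : ℕ} (x : Fin n → 𝔤) (p q : LieSeries n) :
    eval x (bch p q) = BCH (eval x p) (eval x q) := by
  have h : (eval x).comp (LieSeries.subst ![p, q]) = eval ![eval x p, eval x q] := by
    refine hom_ext ((continuous_eval x).comp (continuous_subst _)) (continuous_eval _) fun i => ?_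
    rw [LieHom.comp_apply, subst_gen, eval_gen]
    fin_cases i <;> rfl
  rw [BCH, ← h, LieHom.comp_apply, subst_bch, subst_gen, subst_gen]
  rfl

variable {X : Type*} (A : GAction 𝔤 X) {n : ℕ} (x : Fin n → 𝔤)

theorem GAction.u_bch (p q : LieSeries n) (a : X) :
    A.u (eval x (bch p q)) a = A.u (eval x q) (A.u (eval x p) a) := by
  rw [eval_bch, A.comp]

theorem GAction.u_neg {p : LieSeries n} {a b : X} (h : A.u (eval x p) a = b) :
    A.u (eval x (-p)) b = a := by
  rw [← h, ← A.u_bch, bch_neg_right, map_zero, A.zero]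

/-- If `p` and `q` both map `a` to `b`, then `BCH(-p, q)` fixes `b`. -/
theorem GAction.u_bch_neg {p q : LieSeries n} {a b : X} (hp : A.u (eval x p) a = b)
    (hq : A.u (eval x q) a = b) : A.u (eval x (bch (-p) q)) b = b := by
  rw [A.u_bch, A.u_neg x hp, hq]

theorem GAction.isStabilizer [TopologicalSpace X] [T1Space X] (hA : A.IsContinuous) (b : X) :
    IsStabilizer {p : LieSeries n | A.u (eval x p) b = b} where
  isClosed := isClosed_singleton.preimage ((hA b).comp (continuous_eval x))
  zero_mem := by
    change A.u (eval x 0) b = b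
    rw [map_zero, A.zero]
  bch_mem p hp q hq := by
    change A.u (eval x (bch p q)) b = b
    rw [A.u_bch, show A.u (eval x p) b = b from hp, show A.u (eval x q) b = b from hq]
  half_mem p hp := by
    change A.u (eval x _) b = b
    rw [map_smul]
    exact A.half _ _ hp

theorem GAction.u_mean [TopologicalSpace X] [T1Space X] (hA : A.IsContinuous) (hn : 1 ≤ n)
    {a b : X} (h : ∀ i, A.u (x i) a = b) : A.u (eval x (mean n)) a = b := by
  have hstep : ∀ z : LieSeries n, A.u (eval x z) a = b → A.u (eval x (meanStep gen z)) a = b := by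
    intro z hz
    have hS := A.isStabilizer x hA b
    rw [meanStep, A.u_bch, hz]
    refine hS.smul_mem (by positivity) (hS.sum_mem _ fun i _ => ?_)
    exact A.u_bch_neg x hz (by rw [eval_gen, h])
  have hiter : ∀ d : ℕ, A.u (eval x ((meanStep gen)^[d] (gen ⟨0, hn⟩))) a = b := by
    intro d
    induction d with
    | zero => rw [Function.iterate_zero_apply, eval_gen, h]
    | succ d ih => rw [Function.iterate_succ_apply']; exact hstep _ ih
  have hlim := (meanStep_contractive (by omega : n ≠ 0) gen).tendsto_iterate (meanStep_mean n)
    (gen ⟨0, hn⟩)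
  exact (isClosed_singleton.preimage ((hA a).comp (continuous_eval x))).mem_of_tendsto hlim
    (Filter.Eventually.of_forall hiter)

theorem GAction.u_mean_two (x : Fin 2 → 𝔤) {a b : X} (h : ∀ i, A.u (x i) a = b) :
    A.u (eval x (mean 2)) a = b := by
  have hg : ∀ i, A.u (eval x (gen i)) a = b := fun i => by rw [eval_gen, h]
  rw [mean_two, A.u_bch, hg, map_smul]
  exact A.half _ _ (A.u_bch_neg x (hg 0) (hg 1))

end Action

end GaugeAverage

end

theorem theorem3p2 :
    ∃ μ : (n : ℕ) → LieSeries n,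
      -- total symmetry
      (∀ n : ℕ, LieSeries.TotallySymmetric (μ n)) ∧
      -- the averaging property, for continuous actions
      (∀ n : ℕ, 1 ≤ n →
        ∀ (𝔤 : Type*) [LieRing 𝔤] [LieAlgebra ℚ 𝔤] [TopologicalSpace 𝔤] [AdmitsLieSeries 𝔤]
          (X : Type*) [TopologicalSpace X] [T1Space X] (A : GAction 𝔤 X), A.IsContinuous →
          ∀ (x : Fin n → 𝔤) (a b : X), (∀ i, A.u (x i) a = b) → A.u (eval x (μ n)) a = b) ∧
      -- for two elements the averaging property needs no continuity
      (∀ (𝔤 : Type*) [LieRing 𝔤] [LieAlgebra ℚ 𝔤] [TopologicalSpace 𝔤] [AdmitsLieSeries 𝔤]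
          (X : Type*) (A : GAction 𝔤 X) (x : Fin 2 → 𝔤) (a b : X),
          (∀ i, A.u (x i) a = b) → A.u (eval x (μ 2)) a = b) ∧
      -- the explicit formula for two elements
      μ 2 = LieSeries.bch (LieSeries.gen 0)
        ((1 / 2 : ℚ) • LieSeries.bch (-LieSeries.gen 0) (LieSeries.gen 1)) :=
  ⟨LieSeries.mean, LieSeries.mean_totallySymmetric,
    fun _ hn _ _ _ _ _ _ _ _ A hA x _ _ h => A.u_mean x hA hn h,
    fun _ _ _ _ _ _ A x _ _ h => A.u_mean_two x h, LieSeries.mean_two⟩
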